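/- Let $n\ge 2$ and $k,m\ge 0$, let $X\subset(\mathbb R^n)^k$ be compact, let $f\colon X\to(\mathbb R^n)^m$ be a map, and let $U\subset X$. Definitions. A \emph{classical linkage} $\mathcal L$ in $\mathbb R^n$ consists of a finite simple graph, a length $\ell(e)>0$ for each edge $e$, a subset $V$ of the vertices (the fixed vertices), and a map $\mu\colon V\to\mathbb R^n$. Its configuration space $\mathcal C(\mathcal L)$ is the set of all maps $\varphi$ from the vertices to $\mathbb R^n$ with $\varphi(v)=\mu(v)$ for $v\in V$ and $|\varphi(v)-\varphi(w)|=\ell(vw)$ for every edge $vw$. A map between subsets of Euclidean spaces is \emph{analytic} if it is the restriction of a real analytic map defined on an open neighbourhood of its source; a bijection is an \emph{analytic isomorphism} if it and its inverse are analytic. A finite set $F$ is regarded as a finite set of real numbers (so that $U\times F$ is a subset of a Euclidean space). The linkage $\mathcal L$ is \emph{functional for $f$ with domain $X$ and restricted domain $U$} if there are vertices $w_1,\dots,w_k$ and $v_1,\dots,v_m$ of $\mathcal L$ (repetitions allowed) such that the maps $q(\varphi)=(\varphi(w_1),\dots,\varphi(w_k))$ and $p(\varphi)=(\varphi(v_1),\dots,\varphi(v_m))$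 on $\mathcal C(\mathcal L)$ satisfy $q(\mathcal C(\mathcal L))=X$ and $p=f\circ q$, and such that $q\colon q^{-1}(U)\to U$ is an analytically trivial covering, i.e. there are a finite set $F$ and an analytic isomorphism $\sigma\colon U\times F\to q^{-1}(U)$ with $q\sigma(x,c)=x$ for all $(x,c)$. Theorem. The following are equivalent: 1. There is a classical linkage $\mathcal L$ in $\mathbb R^n$ which is functional for $f$ with domain $X$ and restricted domain $U$. 2. There are a compact real algebraic set $Y\subset\mathbb R^N$ (for some $N$), polynomial maps $q\colon Y\to X$ and $p\colon Y\to(\mathbb R^n)^m$, a finite set $F$, and an analytic map $\sigma\colon U\times F\to Y$ such that (a) $p=f\circ q$; (b) $q$ is onto; (c) $q\sigma(x,c)=x$ for all $(x,c)\in U\times F$; (d) $\sigma$ is an analytic isomorphism onto $q^{-1}(U)$. -/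

import Mathlib

open Set

/-- A classical linkage in `ℝⁿ`: a finite one dimensional simplicial complex (a finite simple graph,
possibly disconnected), a positive length for every edge, a set of fixed vertices, and the points of
`ℝⁿ` at which these are fixed. -/
structure ClassicalLinkage (n : ℕ) where
  /-- the vertices -/
  Vertex : Type
  vertexFintype : Fintype Vertex
  /-- the edges -/
  graph : SimpleGraph Vertex
  /-- the length of each edge -/
  length : graph.edgeSet → ℝ
  length_pos : ∀ e, 0 < length e
  /-- the set of fixed vertices -/
  fixed : Set Vertex
  /-- where the fixed vertices are fixed -/
  position : fixed → EuclideanSpace ℝ (Fin n)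

attribute [instance] ClassicalLinkage.vertexFintype

namespace ClassicalLinkage

variable {n : ℕ}

/-- The configuration space: all maps from the vertices to `ℝⁿ` which take the prescribed values on
the fixed vertices and realize the length of every edge. -/
def configSpace (L : ClassicalLinkage n) : Set (L.Vertex → EuclideanSpace ℝ (Fin n)) :=
  {φ | (∀ v : L.fixed, φ v = L.position v) ∧
    ∀ (v w : L.Vertex) (h : L.graph.Adj v w), dist (φ v) (φ w) = L.length ⟨s(v, w), h⟩}

/-- The map `φ ↦ (φ (w₁), …, φ (w_k))` reading off the positions of a list of vertices (repetitions
allowed). -/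
def positions (L : ClassicalLinkage n) {k : ℕ} (w : Fin k → L.Vertex)
    (φ : L.Vertex → EuclideanSpace ℝ (Fin n)) : Fin k → EuclideanSpace ℝ (Fin n) :=
  fun i => φ (w i)

end ClassicalLinkage

/-- `g` restricted to `A` is an analytic map: it is the restriction to `A` of a map which is analytic
(locally given by power series) on an open neighbourhood of `A`. (The set of points at which `h` is
analytic is open.) -/
def IsAnalyticMapOn {E G : Type*} [NormedAddCommGroup E] [NormedSpace ℝ E]
    [NormedAddCommGroup G] [NormedSpace ℝ G] (g : E → G) (A : Set E) : Prop :=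
  ∃ h : E → G, AnalyticOnNhd ℝ h A ∧ EqOn g h A

/-- `g` restricts to an analytic isomorphism from `A` onto `B`: a bijection such that it and its inverse
are both restrictions of analytic maps. -/
def IsAnalyticIso {E G : Type*} [NormedAddCommGroup E] [NormedSpace ℝ E]
    [NormedAddCommGroup G] [NormedSpace ℝ G] (g : E → G) (A : Set E) (B : Set G) : Prop :=
  BijOn g A B ∧ IsAnalyticMapOn g A ∧ ∃ g' : G → E, InvOn g' g A B ∧ IsAnalyticMapOn g' B

/-- The restriction `C ∩ q⁻¹(U) → U` of `q` is an analytically trivial (finite) covering map: there are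
a finite set `F` and an analytic isomorphism `σ` from `U × F` onto `C ∩ q⁻¹(U)` with `q (σ (x, c)) = x`.
The finite discrete set `F` is realized as a set of real numbers, so that `U × F` is a subset of a
Euclidean space. -/
def IsAnalyticallyTrivialCover {E G : Type*} [NormedAddCommGroup E] [NormedSpace ℝ E]
    [NormedAddCommGroup G] [NormedSpace ℝ G] (q : E → G) (C : Set E) (U : Set G) : Prop :=
  ∃ (F : Set ℝ) (σ : G × ℝ → E), F.Finite ∧
    (∀ x ∈ U, ∀ c ∈ F, q (σ (x, c)) = x) ∧ IsAnalyticIso σ (U ×ˢ F) (C ∩ q ⁻¹' U)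

/-- The linkage `L` is functional for `f : X → (ℝⁿ)ᵐ` with domain `X` and restricted domain `U`: for some
choice of input vertices `w` and output vertices `v`, with input map `q` and output map `p` on the
configuration space, the image of `q` is `X`, `p = f ∘ q`, `U ⊆ X`, and `q` is an analytically trivial
covering map over `U`. -/
def ClassicalLinkage.IsFunctional {n k m : ℕ} (L : ClassicalLinkage n)
    {X : Set (Fin k → EuclideanSpace ℝ (Fin n))} (f : X → Fin m → EuclideanSpace ℝ (Fin n))
    (U : Set (Fin k → EuclideanSpace ℝ (Fin n))) : Prop :=
  ∃ (w : Fin k → L.Vertex) (v : Fin m → L.Vertex),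
    L.positions w '' L.configSpace = X ∧
    (∀ φ ∈ L.configSpace, ∀ h : L.positions w φ ∈ X, L.positions v φ = f ⟨L.positions w φ, h⟩) ∧
    U ⊆ X ∧
    IsAnalyticallyTrivialCover (L.positions w) L.configSpace U

/-- A real algebraic set: the common zeros in `ℝᴺ` of a collection of real polynomials. -/
def IsRealAlgebraicSet {N : ℕ} (Y : Set (Fin N → ℝ)) : Prop :=
  ∃ S : Set (MvPolynomial (Fin N) ℝ), Y = {y | ∀ P ∈ S, MvPolynomial.eval y P = 0}

/-- A polynomial map `ℝᴺ → (ℝⁿ)ᵏ`: every real coordinate is a polynomial. -/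
def IsPolynomialMap {N n k : ℕ} (g : (Fin N → ℝ) → Fin k → EuclideanSpace ℝ (Fin n)) : Prop :=
  ∀ (i : Fin k) (j : Fin n), ∃ P : MvPolynomial (Fin N) ℝ, ∀ y, g y i j = MvPolynomial.eval y P

open scoped ContDiff

/-! From algebra to linkages, the configuration spaces are handled as sets of families of unit
vectors cut out by linear equations (`IsUnitLinear`). Such a set is the configuration space of a
linkage as soon as it is nonempty: take a finite grid of integer-like combinations `∑ c i • u i` as
vertices and join points that differ in one coordinate. `grid_rigidity` shows that the edge lengths
alone force this affine form, and a linear equation is imposed by fixing a vertex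
(`IsUnitLinear.exists_linkage`).

The predicate `Realizes Z D 𝒢` then serves as a calculus. A system of unit vectors has a parameter
that never leaves `Z`; over `D` its fibres are enumerated by finitely many disjoint analytic
sections; the functions in `𝒢` are linear combinations of the vectors. Addition is thus free, and
systems can be multiplied, constrained and reparametrized. The only nonlinear device is a
Peaucellier cell (`realizes_circleInversion`), in which an auxiliary chain excludes the degenerate
positions. Inversion yields straight lines and reciprocals, reciprocals yield squares, squares yield
products, and a right triangle moves a real quantity to another axis. Hence all polynomial maps are
realized over a cube (`realizes_polynomial`); setting the defining polynomials of `Y` to zero gives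
`Realizes Y Y 𝒢` (`realizes_algebraic`). Composing the sections with the given covering `σ` gives
the trivial covering over `U`.

Conversely a configuration space is already real algebraic, but components of the linkage without
bounded position make it noncompact. Freezing the vertices of unbounded position gives a compact
`Y`. They cannot influence the inputs, and they do not exist when `U` is nonempty, because fibres
over `U` are finite (`ClassicalLinkage.IsFunctional.exists_algebraic`). -/

/-! ### Rigidity of grids -/

/-- The two distances determine the inner product of `x` with `v`, and this is the equality case of
Cauchy–Schwarz: a bar with collinear marked points stays straight. -/
theorem eq_smul_of_norm_eq {E : Type*} [NormedAddCommGroup E] [InnerProductSpace ℝ E]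
    {x v : E} {t : ℝ} (hv : ‖v‖ = 1) (hx : ‖x‖ = |t|) (hxv : ‖x - v‖ = |t - 1|) : x = t • v := by
  have h1 := norm_sub_sq_real x v
  have h2 := norm_sub_sq_real x (t • v)
  rw [hxv, hx, hv, sq_abs, sq_abs] at h1
  rw [hx, norm_smul, hv, inner_smul_right, mul_one, Real.norm_eq_abs, sq_abs] at h2
  have h3 : inner ℝ x v = t := by linarith
  rw [h3] at h2
  have h4 : ‖x - t • v‖ ^ 2 = 0 := by rw [h2]; ring
  exact sub_eq_zero.1 (norm_eq_zero.1 (pow_eq_zero_iff (two_ne_zero)|>.1 h4))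

theorem eq_zero_of_norm_add_sub {E : Type*} [NormedAddCommGroup E] [InnerProductSpace ℝ E]
    {a b : E} (h0 : ‖a‖ = 1) (h1 : ‖a + b‖ = 1) (h2 : ‖a - b‖ = 1) : b = 0 := by
  have := parallelogram_law_with_norm ℝ a b
  rw [h0, h1, h2] at this
  exact norm_eq_zero.1 (mul_self_eq_zero.1 (by linarith))

/-- A map from a grid which preserves the distances along all coordinate lines is affine. -/
theorem grid_rigidity {E ι : Type*} [NormedAddCommGroup E] [InnerProductSpace ℝ E] [Fintype ι]
    [DecidableEq ι] {W : Set ℝ} (h0 : (0 : ℝ) ∈ W) (h1 : (1 : ℝ) ∈ W) (hm : (-1 : ℝ) ∈ W)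
    (p : (ι → W) → E)
    (hp : ∀ (c : ι → W) (i : ι) (t : W), dist (p c) (p (Function.update c i t)) = |(c i : ℝ) - t|) :
    ∃ u : ι → E, (∀ i, ‖u i‖ = 1) ∧
      ∀ c, p c = p (fun _ => ⟨0, h0⟩) + ∑ i, (c i : ℝ) • u i := by
  set o : W := ⟨0, h0⟩
  set e : W := ⟨1, h1⟩
  set m : W := ⟨-1, hm⟩
  have hp' : ∀ (c : ι → W) (i : ι) (s t : W),
      dist (p (Function.update c i s)) (p (Function.update c i t)) = |(s : ℝ) - t| := by
    intro c i s t
    simpa using hp (Function.update c i s) i t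
  let d : ι → (ι → W) → E := fun i c => p (Function.update c i e) - p (Function.update c i o)
  have hd : ∀ i c, ‖d i c‖ = 1 := by
    intro i c
    rw [← dist_eq_norm, hp']
    simp [e, o]
  have hline : ∀ i c (t : W),
      p (Function.update c i t) = p (Function.update c i o) + (t : ℝ) • d i c := by
    intro i c t
    rw [← sub_eq_iff_eq_add']
    apply eq_smul_of_norm_eq (hd i c)
    · rw [← dist_eq_norm, hp']; simp [o]
    · rw [sub_sub_sub_cancel_right, ← dist_eq_norm, hp']
  -- The direction of an `i`-line depends affinely on the `j`-th coordinate and has norm 1 at `0`,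
  -- `1` and `-1`; the parallelogram law makes the slope vanish. The value `-1` excludes folded
  -- rhombi.
  have hconst : ∀ i j c (s : W), i ≠ j →
      d i (Function.update c j s) = d i (Function.update c j o) := by
    intro i j c s hij
    have key : ∀ s : W, d i (Function.update c j s) = d i (Function.update c j o) +
        (s : ℝ) • (d j (Function.update c i e) - d j (Function.update c i o)) := by
      intro s
      have e1 := hline j (Function.update c i e) s
      have e2 := hline j (Function.update c i o) s
      simp only [d, Function.update_comm hij] at e1 e2 ⊢
      rw [e1, e2]
      module
    have hz : d j (Function.update c i e) - d j (Function.update c i o) = 0 := by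
      apply eq_zero_of_norm_add_sub (hd i (Function.update c j o))
      · have := key e
        simp only [e, one_smul] at this
        rw [← this]; exact hd _ _
      · have := key m
        simp only [m, neg_smul, one_smul, ← sub_eq_add_neg] at this
        rw [← this]; exact hd _ _
    rw [key, hz, smul_zero, add_zero]
  refine ⟨fun i => d i fun _ => o, fun i => hd _ _, ?_⟩
  intro c
  -- The coordinates are switched on one at a time, starting from the origin of the grid.
  have main : ∀ A : Finset ι,
      (∀ i, d i (fun j => if j ∈ A then c j else o) = d i fun _ => o) ∧
      p (fun j => if j ∈ A then c j else o) =
        p (fun _ => o) + ∑ i ∈ A, (c i : ℝ) • d i fun _ => o := by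
    intro A
    induction A using Finset.induction_on with
    | empty => simp
    | insert a A ha ih =>
      have hup : (fun j => if j ∈ insert a A then c j else o) =
          Function.update (fun j => if j ∈ A then c j else o) a (c a) := by
        ext j
        by_cases hj : j = a
        · subst hj; simp
        · simp [hj]
      have hup' : Function.update (fun j => if j ∈ A then c j else o) a o =
          (fun j => if j ∈ A then c j else o) := by
        ext j
        by_cases hj : j = a
        · subst hj; simp [ha]
        · simp [hj]
      rw [hup]
      constructor
      · intro i
        by_cases hi : i = a
        · subst hi
          rw [← ih.1 i]
          simp [d]
        · rw [hconst i a _ _ hi, hup', ih.1]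
      · rw [hline, hup', ih.1, ih.2, Finset.sum_insert ha]
        abel
  simpa using (main Finset.univ).2

/-! ### Systems of unit vectors as linkages -/

/-- A set of families of unit vectors cut out by finitely many linear equations with real
coefficients. -/
def IsUnitLinear {E ι : Type*} [NormedAddCommGroup E] [NormedSpace ℝ E] [Fintype ι]
    (S : Set (ι → E)) : Prop :=
  ∃ T : Set ((ι → ℝ) × E), T.Finite ∧
    S = {u | (∀ i, ‖u i‖ = 1) ∧ ∀ t ∈ T, ∑ i, t.1 i • u i = t.2}

/-- The linkage on a grid, with edges along the coordinate lines. -/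
def gridLinkage {n : ℕ} {ι : Type} [Fintype ι] [DecidableEq ι] (W : Set ℝ) [Fintype W]
    (T : Set (ι → W)) (u₀ : ι → EuclideanSpace ℝ (Fin n)) : ClassicalLinkage n where
  Vertex := ι → W
  vertexFintype := inferInstance
  graph :=
    { Adj := fun a b => a ≠ b ∧ ∃ i t, b = Function.update a i t
      symm := ⟨by
        rintro a b ⟨hab, i, t, rfl⟩
        exact ⟨hab.symm, i, a i, by simp⟩⟩
      loopless := ⟨fun a h => h.1 rfl⟩ }
  -- Adjacent points differ in a single coordinate, so only one summand is nonzero; the sum avoids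
  -- naming that coordinate.
  length := fun e => Sym2.lift ⟨fun a b : ι → W => ∑ i, |(a i : ℝ) - b i|, fun a b => by
    simp only [abs_sub_comm]⟩ e.1
  length_pos := by
    rintro ⟨e, he⟩
    induction e using Sym2.ind with
    | _ a b =>
      have hab : a ≠ b := he.1
      obtain ⟨i, hi⟩ := Function.ne_iff.1 hab
      refine Finset.sum_pos' (fun _ _ => abs_nonneg _) ⟨i, Finset.mem_univ _, ?_⟩
      exact abs_pos.2 (sub_ne_zero.2 fun h => hi (Subtype.ext h))
  fixed := T
  position := fun c => ∑ i, (c.1 i : ℝ) • u₀ i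

theorem mem_configSpace_gridLinkage {n : ℕ} {ι : Type} [Fintype ι] [DecidableEq ι] {W : Set ℝ}
    [Fintype W] {T : Set (ι → W)} {u₀ : ι → EuclideanSpace ℝ (Fin n)}
    (φ : (ι → W) → EuclideanSpace ℝ (Fin n)) :
    φ ∈ (gridLinkage W T u₀).configSpace ↔ (∀ c ∈ T, φ c = ∑ i, (c i : ℝ) • u₀ i) ∧
      ∀ (c : ι → W) (i : ι) (t : W),
        dist (φ c) (φ (Function.update c i t)) = |(c i : ℝ) - t| := by
  have hsum : ∀ (c : ι → W) (i : ι) (t : W),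
      ∑ j, |(c j : ℝ) - (Function.update c i t j : W)| = |(c i : ℝ) - t| := by
    intro c i t
    rw [Finset.sum_eq_single i]
    · simp
    · intro j _ hj
      simp [hj]
    · simp
  constructor
  · rintro ⟨hfix, hlen⟩
    refine ⟨fun c hc => hfix ⟨c, hc⟩, fun c i t => ?_⟩
    by_cases hne : c = Function.update c i t
    · have : c i = t := by rw [hne]; simp
      rw [← hne, this]; simp
    · exact (hlen c (Function.update c i t) ⟨hne, i, t, rfl⟩).trans (hsum c i t)
  · rintro ⟨hfix, hlen⟩
    refine ⟨fun c => hfix c.1 c.2, ?_⟩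
    rintro a b ⟨hab, i, t, rfl⟩
    exact (hlen a i t).trans (hsum a i t).symm

/-- A nonempty set of families of unit vectors which is cut out by linear equations is linearly
isomorphic to the configuration space of a linkage, in such a way that given linear combinations are
positions of vertices. -/
theorem IsUnitLinear.exists_linkage {n : ℕ} {ι : Type} [Fintype ι]
    {S : Set (ι → EuclideanSpace ℝ (Fin n))} (hS : IsUnitLinear S) (hne : S.Nonempty)
    {O : Set (ι → ℝ)} (hO : O.Finite) :
    ∃ (L : ClassicalLinkage n)
      (Λ : (ι → EuclideanSpace ℝ (Fin n)) →L[ℝ] (L.Vertex → EuclideanSpace ℝ (Fin n)))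
      (Γ : (L.Vertex → EuclideanSpace ℝ (Fin n)) →L[ℝ] (ι → EuclideanSpace ℝ (Fin n))),
      (∀ u, Γ (Λ u) = u) ∧ L.configSpace = Λ '' S ∧
      ∀ c ∈ O, ∃ v : L.Vertex, ∀ u, Λ u v = ∑ i, c i • u i := by
  classical
  obtain ⟨T, hT, rfl⟩ := hS
  obtain ⟨u₀, hu₀, hTu₀⟩ := hne
  let P : Set (ι → ℝ) := O ∪ Prod.fst '' T
  have hP : P.Finite := hO.union (hT.image _)
  let W : Set ℝ := {0, 1, -1} ∪ ⋃ c ∈ P, range c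
  have hW : W.Finite := (toFinite _).union (hP.biUnion fun c _ => finite_range c)
  have h0 : (0 : ℝ) ∈ W := by simp [W]
  have h1 : (1 : ℝ) ∈ W := by simp [W]
  have hm : (-1 : ℝ) ∈ W := by simp [W]
  have : Fintype W := hW.fintype
  have hPW : ∀ c ∈ P, ∃ c' : ι → W, ∀ i, (c' i : ℝ) = c i := fun c hc =>
    ⟨fun i => ⟨c i, Or.inr (mem_biUnion hc (mem_range_self i))⟩, fun _ => rfl⟩
  -- Fixing the origin removes translations. Fixing a vertex `c` where the reference solution `u₀`
  -- puts it expresses the equation with left side `c`; the solution `u₀` guarantees that the fixed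
  -- positions agree with the right sides.
  let T' : Set (ι → W) := insert (fun _ => ⟨0, h0⟩) {c | (fun i => (c i : ℝ)) ∈ Prod.fst '' T}
  let Λ : (ι → EuclideanSpace ℝ (Fin n)) →L[ℝ] ((ι → W) → EuclideanSpace ℝ (Fin n)) :=
    ContinuousLinearMap.pi fun c : ι → W =>
      ∑ i, (c i : ℝ) • ContinuousLinearMap.proj (R := ℝ)
        (φ := fun _ : ι => EuclideanSpace ℝ (Fin n)) i
  have hΛ : ∀ u (c : ι → W), Λ u c = ∑ i, (c i : ℝ) • u i := by
    intro u c
    simp [Λ]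
  -- The standard basis points of the grid, at which the vectors `u i` themselves are read off.
  let δ : ι → ι → W := fun i => Function.update (fun _ => ⟨0, h0⟩) i ⟨1, h1⟩
  let Γ : ((ι → W) → EuclideanSpace ℝ (Fin n)) →L[ℝ] (ι → EuclideanSpace ℝ (Fin n)) :=
    ContinuousLinearMap.pi fun i => ContinuousLinearMap.proj (R := ℝ)
      (φ := fun _ : ι → W => EuclideanSpace ℝ (Fin n)) (δ i)
  refine ⟨gridLinkage W T' u₀, Λ, Γ, ?_, ?_, ?_⟩
  · intro u
    ext1 i
    change Λ u (δ i) = u i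
    rw [hΛ, Finset.sum_eq_single i]
    · simp [δ]
    · intro j _ hj
      simp [δ, hj]
    · simp
  · refine Set.ext fun (φ : (ι → W) → EuclideanSpace ℝ (Fin n)) =>
      (mem_configSpace_gridLinkage φ).trans ⟨?_, ?_⟩
    · rintro ⟨hfix, hlen⟩
      obtain ⟨u, hu, hφ⟩ := grid_rigidity h0 h1 hm φ hlen
      have hz : φ (fun _ => ⟨0, h0⟩) = 0 := by
        rw [hfix _ (mem_insert _ _)]
        simp
      have hφ' : ∀ c, φ c = ∑ i, (c i : ℝ) • u i := fun c => by rw [hφ, hz, zero_add]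
      refine ⟨u, ⟨hu, ?_⟩, ?_⟩
      · rintro t ht
        obtain ⟨c, hc⟩ := hPW t.1 (Or.inr ⟨t, ht, rfl⟩)
        have h := hfix c (Or.inr ⟨t, ht, funext fun i => (hc i).symm⟩)
        rw [hφ'] at h
        simp only [hc] at h
        rw [h, hTu₀ t ht]
      · funext c
        exact (hΛ u c).trans (hφ' c).symm
    · rintro ⟨u, ⟨hu, hTu⟩, rfl⟩
      change (∀ c ∈ T', Λ u c = _) ∧
        ∀ (c : ι → W) (i : ι) (t : W), dist (Λ u c) (Λ u (Function.update c i t)) = _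
      refine ⟨?_, ?_⟩
      · rintro c (rfl | ⟨t, ht, htc⟩)
        · simp [hΛ]
        · have h1 := hTu t ht
          rw [← hTu₀ t ht, htc] at h1
          rw [hΛ]
          exact h1
      · intro c i t
        rw [hΛ, hΛ, dist_eq_norm, ← Finset.sum_sub_distrib, Finset.sum_eq_single i]
        · simp [← sub_smul, norm_smul, hu]
        · intro j _ hj
          simp [hj]
        · simp
  · intro c hc
    obtain ⟨c', hc'⟩ := hPW c (Or.inl hc)
    exact ⟨c', fun u => (hΛ u c').trans (by simp only [hc'])⟩

/-! ### Realizable systems and their closure properties -/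

/-- A finite family of analytic sections over `D` of a map `r` on `S`, which over each point of `D`
enumerates the fibre without repetition. -/
structure IsSectionFamily {A V Φ : Type*} [NormedAddCommGroup A] [NormedSpace ℝ A]
    [NormedAddCommGroup V] [NormedSpace ℝ V] (r : A → V) (S : Set A) (D : Set V)
    (s : Φ → V → A) : Prop where
  analytic : ∀ i, AnalyticOnNhd ℝ (s i) D
  mem : ∀ i, ∀ x ∈ D, s i x ∈ S
  right_inv : ∀ i, ∀ x ∈ D, r (s i x) = x
  complete : ∀ u ∈ S, r u ∈ D → ∃ i, s i (r u) = u
  injective : ∀ x ∈ D, Function.Injective fun i => s i x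

/-- There is a set `S` of families of unit vectors, cut out by linear equations, and an analytic map
from `S` to `Z` which has a finite family of sections over `D`, such that every function of `𝒢` becomes a
linear combination of the unit vectors. -/
def Realizes {E V : Type*} [NormedAddCommGroup E] [NormedSpace ℝ E] [NormedAddCommGroup V]
    [NormedSpace ℝ V] (Z D : Set V) (𝒢 : Set (V → E)) : Prop :=
  ∃ (ι : Type) (_ : Fintype ι) (S : Set (ι → E)) (r : (ι → E) → V) (Φ : Type) (_ : Finite Φ)
    (_ : Nonempty Φ) (s : Φ → V → ι → E),
    IsUnitLinear S ∧ AnalyticOnNhd ℝ r S ∧ MapsTo r S Z ∧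
    (∀ g ∈ 𝒢, ∃ c : ι → ℝ, ∀ u ∈ S, ∑ i, c i • u i = g (r u)) ∧ IsSectionFamily r S D s

section

variable {E V V' : Type*} [NormedAddCommGroup E] [NormedSpace ℝ E] [NormedAddCommGroup V]
  [NormedSpace ℝ V] [NormedAddCommGroup V'] [NormedSpace ℝ V'] {Z Z' D : Set V} {𝒢 𝒢' : Set (V → E)}

theorem IsSectionFamily.mono {A Φ : Type*} [NormedAddCommGroup A] [NormedSpace ℝ A] {r : A → V}
    {S : Set A} {D D' : Set V} {s : Φ → V → A} (h : IsSectionFamily r S D s) (hD : D' ⊆ D) :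
    IsSectionFamily r S D' s :=
  ⟨fun i => (h.analytic i).mono hD, fun i x hx => h.mem i x (hD hx),
    fun i x hx => h.right_inv i x (hD hx), fun u hu hD' => h.complete u hu (hD hD'),
    fun x hx => h.injective x (hD hx)⟩

theorem Realizes.mono {D' : Set V} (h : Realizes Z D 𝒢) (hZ : Z ⊆ Z') (hD : D' ⊆ D)
    (h𝒢 : ∀ g ∈ 𝒢', ∃ g' ∈ Submodule.span ℝ 𝒢, EqOn g g' Z) : Realizes Z' D' 𝒢' := by
  obtain ⟨ι, _, S, r, Φ, _, _, s, hS, hr, hrZ, hc, hs⟩ := h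
  refine ⟨ι, ‹_›, S, r, Φ, ‹_›, ‹_›, s, hS, hr, hrZ.mono_right hZ, ?_, hs.mono hD⟩
  intro g hg
  obtain ⟨g', hg', hgg⟩ := h𝒢 g hg
  suffices H : ∃ c : ι → ℝ, ∀ u ∈ S, ∑ i, c i • u i = g' (r u) by
    obtain ⟨c, hc⟩ := H
    exact ⟨c, fun u hu => (hc u hu).trans (hgg (hrZ hu)).symm⟩
  clear hgg
  induction hg' using Submodule.span_induction with
  | mem g' h => exact hc g' h
  | zero => exact ⟨0, by simp⟩
  | add x y _ _ hx hy =>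
    obtain ⟨c, hc⟩ := hx
    obtain ⟨c', hc'⟩ := hy
    exact ⟨c + c', fun u hu => by
      simp [add_smul, Finset.sum_add_distrib, hc u hu, hc' u hu]⟩
  | smul a x _ hx =>
    obtain ⟨c, hc⟩ := hx
    exact ⟨a • c, fun u hu => by simp [mul_smul, ← Finset.smul_sum, hc u hu]⟩

theorem Realizes.subset (h : Realizes Z D 𝒢) (h𝒢 : 𝒢' ⊆ Submodule.span ℝ 𝒢) :
    Realizes Z D 𝒢' :=
  h.mono Subset.rfl Subset.rfl fun g hg => ⟨g, h𝒢 hg, eqOn_refl _ _⟩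

/-- Since `g` is a linear combination of the unit vectors, the condition is one more linear equation
on the same family. -/
theorem Realizes.constraint (h : Realizes Z D 𝒢) {g : V → E} (hg : g ∈ 𝒢) (v₀ : E) :
    Realizes (Z ∩ {x | g x = v₀}) (D ∩ {x | g x = v₀}) 𝒢 := by
  obtain ⟨ι, _, S, r, Φ, _, _, s, ⟨T, hT, rfl⟩, hr, hrZ, hc, hs⟩ := h
  obtain ⟨c, hcg⟩ := hc g hg
  refine ⟨ι, ‹_›, {u | (∀ i, ‖u i‖ = 1) ∧ ∀ t ∈ insert (c, v₀) T, ∑ i, t.1 i • u i = t.2}, r, Φ,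
    ‹_›, ‹_›, s, ⟨_, hT.insert _, rfl⟩, ?_⟩
  have hiff : ∀ u, ((∀ i, ‖u i‖ = 1) ∧ ∀ t ∈ insert (c, v₀) T, ∑ i, t.1 i • u i = t.2) ↔
      ((∀ i, ‖u i‖ = 1) ∧ ∀ t ∈ T, ∑ i, t.1 i • u i = t.2) ∧ g (r u) = v₀ := by
    intro u
    simp only [forall_mem_insert]
    constructor
    · rintro ⟨h1, h2, h3⟩
      exact ⟨⟨h1, h3⟩, (hcg u ⟨h1, h3⟩).symm.trans h2⟩
    · rintro ⟨⟨h1, h3⟩, h2⟩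
      exact ⟨h1, (hcg u ⟨h1, h3⟩).trans h2, h3⟩
  simp only [hiff]
  refine ⟨hr.mono fun u hu => hu.1, fun u hu => ⟨hrZ hu.1, hu.2⟩,
    fun g hg => (hc g hg).imp fun c hc u hu => hc u hu.1, ?_⟩
  exact ⟨fun i => (hs.analytic i).mono inter_subset_left,
    fun i x hx => ⟨hs.mem i x hx.1, by rw [hs.right_inv i x hx.1]; exact hx.2⟩,
    fun i x hx => hs.right_inv i x hx.1, fun u hu hD => hs.complete u hu.1 hD.1,
    fun x hx => hs.injective x hx.1⟩

/-- This inserts a bar: a new unit vector, indexed by `none`, is tied to `g - v₀` by a linear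
equation. Being determined by the old vectors, it adds no sheets, but it forces `g - v₀` to have
norm 1. -/
theorem Realizes.unit (h : Realizes Z D 𝒢) {g : V → E} (hg : g ∈ Submodule.span ℝ 𝒢) (v₀ : E) :
    Realizes (Z ∩ {x | ‖g x - v₀‖ = 1}) (D ∩ {x | ‖g x - v₀‖ = 1})
      (insert (fun x => g x - v₀) 𝒢) := by
  replace h : Realizes Z D (insert g 𝒢) :=
    h.subset (insert_subset hg Submodule.subset_span)
  obtain ⟨ι, _, S, r, Φ, _, _, s, ⟨T, hT, rfl⟩, hr, hrZ, hc, hs⟩ := h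
  obtain ⟨c, hcg⟩ := hc g (mem_insert _ _)
  let ext : (ι → ℝ) → ℝ → Option ι → ℝ := fun c a i => i.elim a c
  let T' : Set ((Option ι → ℝ) × E) := insert (ext c (-1), v₀) ((fun t => (ext t.1 0, t.2)) '' T)
  set S : Set (ι → E) := {u | (∀ i, ‖u i‖ = 1) ∧ ∀ t ∈ T, ∑ i, t.1 i • u i = t.2} with hS
  have hres : ContDiff ℝ ⊤ fun (u : Option ι → E) (i : ι) => u (some i) := by fun_prop
  have hiff : ∀ u : Option ι → E,
      ((∀ i, ‖u i‖ = 1) ∧ ∀ t ∈ T', ∑ i, t.1 i • u i = t.2) ↔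
      (fun i => u (some i)) ∈ S ∧ u none = g (r fun i => u (some i)) - v₀ ∧
        ‖g (r fun i => u (some i)) - v₀‖ = 1 := by
    intro u
    simp only [T', forall_mem_insert, forall_mem_image, Fintype.sum_option, Option.forall, ext,
      Option.elim_none, Option.elim_some, zero_smul, zero_add, neg_smul, one_smul, hS,
      mem_ofPred_eq]
    constructor
    · rintro ⟨⟨h0, h1⟩, h2, h3⟩
      have h4 : u none = g (r fun i => u (some i)) - v₀ := by
        rw [← hcg _ ⟨h1, h3⟩, ← h2]; abel
      exact ⟨⟨h1, h3⟩, h4, h4 ▸ h0⟩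
    · rintro ⟨⟨h1, h3⟩, h2, h4⟩
      refine ⟨⟨h2 ▸ h4, h1⟩, ?_, h3⟩
      rw [h2, ← hcg _ ⟨h1, h3⟩]; abel
  refine ⟨Option ι, inferInstance,
    {u | (∀ i, ‖u i‖ = 1) ∧ ∀ t ∈ T', ∑ i, t.1 i • u i = t.2},
    fun u => r fun i => u (some i), Φ, ‹_›, ‹_›,
    fun j x i => i.elim (∑ i, c i • s j x i - v₀) (s j x), ⟨_, (hT.image _).insert _, rfl⟩, ?_⟩
  simp only [hiff]
  have hsg : ∀ j, ∀ x ∈ D, ∑ i, c i • s j x i = g x := fun j x hx => by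
    rw [hcg _ (hs.mem j x hx), hs.right_inv j x hx]
  refine ⟨?_, fun u hu => ⟨hrZ hu.1, hu.2.2⟩, ?_, ?_⟩
  · intro u hu
    exact AnalyticAt.comp (g := r) (hr _ hu.1) (hres.contDiffAt.analyticAt)
  · intro g' hg'
    rcases hg' with rfl | hg'
    · refine ⟨ext 0 1, fun u hu => ?_⟩
      simp [ext, Fintype.sum_option, hu.2.1]
    · obtain ⟨c', hc'⟩ := hc g' (mem_insert_of_mem _ hg')
      refine ⟨ext c' 0, fun u hu => ?_⟩
      simp [ext, Fintype.sum_option, hc' _ hu.1]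
  · refine ⟨?_, ?_, ?_, ?_, ?_⟩
    · intro j x hx
      have hj := analyticAt_pi_iff.1 (hs.analytic j x hx.1)
      refine analyticAt_pi_iff.2 fun i => ?_
      cases i with
      | none =>
        exact (Finset.analyticAt_fun_sum _ fun i _ => (hj i).const_smul).sub analyticAt_const
      | some i => exact hj i
    · intro j x hx
      refine ⟨hs.mem j x hx.1, ?_, ?_⟩
      · simp only [Option.elim_none, Option.elim_some]
        rw [hsg j x hx.1, hs.right_inv j x hx.1]
      · simp only [Option.elim_some]
        rw [hs.right_inv j x hx.1]
        exact hx.2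
    · intro j x hx
      exact hs.right_inv j x hx.1
    · intro u hu hD
      obtain ⟨j, hj⟩ := hs.complete _ hu.1 hD.1
      refine ⟨j, ?_⟩
      funext i
      cases i with
      | none =>
        simp only [Option.elim_none]
        rw [hsg j _ hD.1, hu.2.1]
      | some i => exact congrFun hj i
    · intro x hx j j' hjj
      apply hs.injective x hx.1
      funext i
      exact congrFun hjj (some i)

theorem Realizes.prod {Z' D' : Set V'} {𝒢' : Set (V' → E)} (h : Realizes Z D 𝒢)
    (h' : Realizes Z' D' 𝒢') :
    Realizes (Z ×ˢ Z') (D ×ˢ D')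
      ((fun g (x : V × V') => g x.1) '' 𝒢 ∪ (fun g (x : V × V') => g x.2) '' 𝒢') := by
  obtain ⟨ι, _, S, r, Φ, _, _, s, ⟨T, hT, hST⟩, hr, hrZ, hc, hs⟩ := h
  obtain ⟨ι', _, S', r', Φ', _, _, s', ⟨T', hT', hST'⟩, hr', hrZ', hc', hs'⟩ := h'
  have hl : ContDiff ℝ ⊤ fun (u : ι ⊕ ι' → E) (i : ι) => u (Sum.inl i) := by fun_prop
  have hl' : ContDiff ℝ ⊤ fun (u : ι ⊕ ι' → E) (i : ι') => u (Sum.inr i) := by fun_prop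
  refine ⟨ι ⊕ ι', inferInstance,
    {u | (fun i => u (Sum.inl i)) ∈ S ∧ (fun i => u (Sum.inr i)) ∈ S'},
    fun u => (r fun i => u (Sum.inl i), r' fun i => u (Sum.inr i)), Φ × Φ', inferInstance,
    inferInstance, fun j x => Sum.elim (s j.1 x.1) (s' j.2 x.2), ?_, ?_, ?_, ?_, ?_⟩
  · refine ⟨(fun t => (Sum.elim t.1 0, t.2)) '' T ∪ (fun t => (Sum.elim 0 t.1, t.2)) '' T',
      (hT.image _).union (hT'.image _), ?_⟩
    ext u
    simp only [hST, hST', mem_ofPred_eq, mem_union, or_imp, forall_and, forall_mem_image,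
      Fintype.sum_sum_type, Sum.elim_inl, Sum.elim_inr, Sum.forall, Pi.zero_apply, zero_smul,
      Finset.sum_const_zero, add_zero, zero_add]
    tauto
  · intro u hu
    exact (AnalyticAt.comp (g := r) (hr _ hu.1) hl.contDiffAt.analyticAt).prod
      (AnalyticAt.comp (g := r') (hr' _ hu.2) hl'.contDiffAt.analyticAt)
  · exact fun u hu => ⟨hrZ hu.1, hrZ' hu.2⟩
  · rintro _ (⟨g, hg, rfl⟩ | ⟨g, hg, rfl⟩)
    · obtain ⟨c, hc⟩ := hc g hg
      exact ⟨Sum.elim c 0, fun u hu => by simp [hc _ hu.1]⟩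
    · obtain ⟨c, hc⟩ := hc' g hg
      exact ⟨Sum.elim 0 c, fun u hu => by simp [hc _ hu.2]⟩
  · refine ⟨?_, ?_, ?_, ?_, ?_⟩
    · rintro j x ⟨hx, hx'⟩
      refine analyticAt_pi_iff.2 fun i => ?_
      cases i with
      | inl i =>
        exact AnalyticAt.comp (g := fun y => s j.1 y i)
          (analyticAt_pi_iff.1 (hs.analytic j.1 _ hx) i) analyticAt_fst
      | inr i =>
        exact AnalyticAt.comp (g := fun y => s' j.2 y i)
          (analyticAt_pi_iff.1 (hs'.analytic j.2 _ hx') i) analyticAt_snd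
    · exact fun j x hx => ⟨hs.mem _ _ hx.1, hs'.mem _ _ hx.2⟩
    · exact fun j x hx => Prod.ext (hs.right_inv _ _ hx.1) (hs'.right_inv _ _ hx.2)
    · rintro u hu hD
      obtain ⟨j, hj⟩ := hs.complete _ hu.1 hD.1
      obtain ⟨j', hj'⟩ := hs'.complete _ hu.2 hD.2
      refine ⟨(j, j'), funext fun i => ?_⟩
      cases i with
      | inl i => exact congrFun hj i
      | inr i => exact congrFun hj' i
    · rintro x hx ⟨i, i'⟩ ⟨j, j'⟩ hij
      refine Prod.ext (hs.injective _ hx.1 (funext fun k => congrFun hij (Sum.inl k)))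
        (hs'.injective _ hx.2 (funext fun k => congrFun hij (Sum.inr k)))

/-- The parameter is replaced by a function `a` of it. Section families compose, so the sheets are
indexed by `Φ × Ψ`; this lets auxiliary parameters be forgotten. -/
theorem Realizes.reparam (h : Realizes Z D 𝒢) {Z' D' : Set V'} {𝒢' : Set (V' → E)} {a : V → V'}
    {Ψ : Type} [Finite Ψ] [Nonempty Ψ] {b : Ψ → V' → V} (ha : AnalyticOnNhd ℝ a Z)
    (haZ : MapsTo a Z Z') (hb : IsSectionFamily a Z D' b) (hbD : ∀ j, MapsTo (b j) D' D)
    (h𝒢 : ∀ g' ∈ 𝒢', ∃ g ∈ Submodule.span ℝ 𝒢, ∀ x ∈ Z, g' (a x) = g x) :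
    Realizes Z' D' 𝒢' := by
  replace h : Realizes Z D (Submodule.span ℝ 𝒢 : Set (V → E)) := h.subset Subset.rfl
  obtain ⟨ι, hι, S, r, Φ, _, _, s, hS, hr, hrZ, hc, hs⟩ := h
  refine ⟨ι, hι, S, fun u => a (r u), Φ × Ψ, inferInstance, inferInstance,
    fun j x => s j.1 (b j.2 x), hS, fun u hu =>
      show AnalyticAt ℝ (a ∘ r) u from (ha _ (hrZ hu)).comp (hr u hu),
    fun u hu => haZ (hrZ hu), ?_, ?_⟩
  · intro g' hg'
    obtain ⟨g, hg, hgg⟩ := h𝒢 g' hg'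
    obtain ⟨c, hc⟩ := hc g hg
    exact ⟨c, fun u hu => (hc u hu).trans (hgg _ (hrZ hu)).symm⟩
  · refine ⟨?_, ?_, ?_, ?_, ?_⟩
    · intro j x hx
      exact (hs.analytic j.1 _ (hbD j.2 hx)).comp (hb.analytic j.2 x hx)
    · exact fun j x hx => hs.mem _ _ (hbD _ hx)
    · intro j x hx
      rw [hs.right_inv _ _ (hbD _ hx), hb.right_inv _ _ hx]
    · intro u hu hD
      obtain ⟨k, hk⟩ := hb.complete _ (hrZ hu) hD
      obtain ⟨j, hj⟩ := hs.complete u hu (hk ▸ hbD k hD)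
      exact ⟨(j, k), show s j (b k (a (r u))) = u by rw [hk, hj]⟩
    · rintro x hx ⟨i, k⟩ ⟨i', k'⟩ hij
      have h1 : s i (b k x) = s i' (b k' x) := hij
      have h2 := congrArg r h1
      rw [hs.right_inv _ _ (hbD k hx), hs.right_inv _ _ (hbD k' hx)] at h2
      obtain rfl := hb.injective x hx h2
      rw [hs.injective _ (hbD k hx) h1]

end

/-! ### Spheres and planar circles -/

theorem realizes_sphere {E : Type*} [NormedAddCommGroup E] [NormedSpace ℝ E] :
    Realizes {x : E | ‖x‖ = 1} {x : E | ‖x‖ = 1} {fun x : E => x} := by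
  refine ⟨Unit, inferInstance, {u | ‖u ()‖ = 1}, fun u => u (), Unit, inferInstance, inferInstance,
    fun _ x _ => x, ⟨∅, finite_empty, by ext; simp [Unique.forall_iff]⟩, ?_, fun u hu => hu, ?_, ?_⟩
  · exact fun u _ => (contDiff_apply ℝ E ()).contDiffAt.analyticAt
  · rintro _ rfl
    exact ⟨1, by simp⟩
  · refine ⟨fun _ x _ => ?_, fun _ x hx => hx, fun _ x _ => rfl, fun u _ _ => ⟨(), rfl⟩,
      fun x _ _ _ _ => rfl⟩
    exact analyticAt_pi_iff.2 fun _ => analyticAt_id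

/-- A rotating bar is kept in the plane `κ ℂ` by making it orthogonal to an orthonormal basis of the
complement. For unit vectors, `x ⟂ b` means `‖x - b‖ = √2`, which is a unit length condition after
scaling by `(√2)⁻¹`. -/
theorem realizes_circle {E : Type*} [NormedAddCommGroup E] [InnerProductSpace ℝ E]
    [FiniteDimensional ℝ E] (κ : ℂ →ₗᵢ[ℝ] E) :
    Realizes {z : ℂ | ‖z‖ = 1} {z : ℂ | ‖z‖ = 1} {fun z => κ z} := by
  classical
  have step : ∀ B : Set E, B.Finite → (∀ b ∈ B, ‖b‖ = 1) →
      Realizes {x : E | ‖x‖ = 1 ∧ ∀ b ∈ B, inner ℝ b x = 0}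
        {x : E | ‖x‖ = 1 ∧ ∀ b ∈ B, inner ℝ b x = 0} {fun x : E => x} := by
    intro B hBfin
    induction B, hBfin using Set.Finite.induction_on with
    | empty => simpa using realizes_sphere
    | @insert b B _ _ ih =>
      intro hB
      rw [forall_mem_insert] at hB
      have hset : {x : E | ‖x‖ = 1 ∧ ∀ b ∈ B, inner ℝ b x = 0} ∩
          {x | ‖(√2)⁻¹ • x - (√2)⁻¹ • b‖ = 1} =
          {x : E | ‖x‖ = 1 ∧ ∀ y ∈ insert b B, inner ℝ y x = 0} := by
        ext x
        simp only [mem_inter_iff, mem_ofPred_eq, forall_mem_insert]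
        have key : ‖x‖ = 1 → (‖(√2)⁻¹ • x - (√2)⁻¹ • b‖ = 1 ↔ inner ℝ b x = 0) := by
          intro hx
          have h1 := norm_sub_sq_real x b
          rw [hx, hB.1, real_inner_comm] at h1
          have h2 : ‖(√2)⁻¹ • x - (√2)⁻¹ • b‖ ^ 2 = ‖x - b‖ ^ 2 / 2 := by
            rw [← smul_sub, norm_smul, mul_pow, norm_inv, inv_pow, Real.norm_eq_abs, sq_abs,
              Real.sq_sqrt zero_le_two]
            ring
          rw [← sq_eq_sq₀ (norm_nonneg _) zero_le_one, h2, h1]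
          constructor <;> intro h <;> linarith
        tauto
      have := (ih hB.2).unit (g := fun x => (√2)⁻¹ • x)
        (Submodule.smul_mem _ _ (Submodule.subset_span rfl)) ((√2)⁻¹ • b)
      rw [hset] at this
      exact this.subset fun g hg => Submodule.subset_span (mem_insert_of_mem _ hg)
  let K : Submodule ℝ E := LinearMap.range κ.toLinearMap
  let B : Set E := range fun i => (stdOrthonormalBasis ℝ Kᗮ i : E)
  have hB : ∀ b ∈ B, ‖b‖ = 1 := by
    rintro _ ⟨i, rfl⟩
    exact (stdOrthonormalBasis ℝ Kᗮ).orthonormal.1 i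
  have hK : ∀ x : E, (∀ b ∈ B, inner ℝ b x = 0) ↔ x ∈ K := by
    intro x
    constructor
    · intro h
      rw [← K.orthogonal_orthogonal, Submodule.mem_orthogonal]
      intro y hy
      have h1 := (stdOrthonormalBasis ℝ Kᗮ).sum_repr ⟨y, hy⟩
      have h2 := congrArg Subtype.val h1
      simp only [Submodule.coe_sum, Submodule.coe_smul] at h2
      rw [← h2, sum_inner]
      refine Finset.sum_eq_zero fun i _ => ?_
      rw [inner_smul_left, h _ (mem_range_self i), mul_zero]
    · rintro h _ ⟨i, rfl⟩
      rw [real_inner_comm]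
      exact (stdOrthonormalBasis ℝ Kᗮ i).2 x h
  -- The adjoint of an isometric embedding is a linear left inverse; it recovers the complex
  -- parameter.
  let A : E →L[ℝ] ℂ := κ.toContinuousLinearMap.adjoint
  have hA : ∀ z, A (κ z) = z := by
    intro z
    refine ext_inner_right ℝ fun y => ?_
    rw [ContinuousLinearMap.adjoint_inner_left]
    exact κ.inner_map_map z y
  have h := step B (finite_range _) hB
  simp only [hK] at h
  refine h.reparam (a := A) (Ψ := Unit) (b := fun _ z => κ z) (fun x _ => A.analyticAt x) ?_ ?_ ?_ ?_
  · rintro x ⟨hx, z, rfl⟩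
    simpa [hA] using hx
  · refine ⟨?_, ?_, ?_, ?_, ?_⟩
    · exact fun _ x _ => κ.toContinuousLinearMap.analyticAt x
    · exact fun _ z hz => ⟨by simpa using hz, z, rfl⟩
    · exact fun _ z _ => hA z
    · rintro x ⟨hx, z, rfl⟩ _
      exact ⟨(), by simp [hA]⟩
    · exact fun _ _ _ _ _ => rfl
  · exact fun _ z hz => ⟨by simpa using hz, z, rfl⟩
  · rintro _ rfl
    refine ⟨_, Submodule.subset_span rfl, ?_⟩
    rintro x ⟨hx, z, rfl⟩
    simp [hA]

/-! ### The Peaucellier cell with a tether -/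

/-- Equidistance from `w` and `-w` puts `h` on the perpendicular `ℝ i w`; the norm formula is
Pythagoras. -/
theorem exists_eq_smul_of_norm_sub_eq_norm_add {h w : ℂ} (hw : w ≠ 0) (hhw : ‖h - w‖ = ‖h + w‖) :
    ∃ x : ℝ, h = x • (Complex.I * w) ∧ ‖h + w‖ ^ 2 = (x ^ 2 + 1) * ‖w‖ ^ 2 := by
  have h1 : ‖h - w‖ ^ 2 = ‖h + w‖ ^ 2 := by rw [hhw]
  have hw0 : w.re ^ 2 + w.im ^ 2 ≠ 0 := by
    rw [sq, sq, ← Complex.normSq_apply]; simpa using hw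
  simp only [Complex.sq_norm, Complex.normSq_apply, Complex.sub_re, Complex.sub_im, Complex.add_re,
    Complex.add_im] at h1
  have h2 : h.re * w.re + h.im * w.im = 0 := by linarith
  have hx : h = ((h.im * w.re - h.re * w.im) / (w.re ^ 2 + w.im ^ 2)) •
      (Complex.I * w) := by
    apply Complex.ext
    · simp only [Complex.real_smul, Complex.mul_re, Complex.mul_im, Complex.ofReal_re,
        Complex.ofReal_im, Complex.I_re, Complex.I_im]
      field_simp
      linear_combination w.re * h2
    · simp only [Complex.real_smul, Complex.mul_re, Complex.mul_im, Complex.ofReal_re,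
        Complex.ofReal_im, Complex.I_re, Complex.I_im]
      field_simp
      linear_combination w.im * h2
  refine ⟨_, hx, ?_⟩
  generalize ((h.im * w.re - h.re * w.im) / (w.re ^ 2 + w.im ^ 2)) = x at hx
  rw [hx]
  simp only [Complex.sq_norm, Complex.normSq_apply, Complex.add_re, Complex.add_im,
    Complex.real_smul, Complex.mul_re, Complex.mul_im, Complex.ofReal_re,
    Complex.ofReal_im, Complex.I_re, Complex.I_im]
  ring

/-- The inversion in the unit circle. -/
noncomputable def circleInversion (c : ℂ) : ℂ := (‖c‖ ^ 2)⁻¹ • c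

/-- The squared half diagonal of the Peaucellier cell as a function of `c`. -/
noncomputable def cellWidth (c : ℂ) : ℝ := 4 - (‖c‖ ^ 2 + 2 + (‖c‖ ^ 2)⁻¹) / 4

/-- On the base from `0` to `2w` stand isosceles triangles with legs `2` and `√3` and apexes `2b`
and `√3 v`. Their signed heights have squares differing by `4 - 3 = 1`, so the sum and the
difference of the heights, both along `i w`, are inverse to each other. Here `w ≠ 0` is essential:
for `w = 0` the two triangles turn independently. -/
theorem peaucellier_cell {b v w : ℂ} (hb : ‖b‖ = 1) (hv : ‖v‖ = 1) (hw : w ≠ 0)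
    (hd : ‖b - w‖ = 1) (hu : ‖v - (2 / √3) • w‖ = 1) :
    (2 : ℝ) • b - √3 • v ≠ 0 ∧
    (2 : ℝ) • b + √3 • v - (2 : ℝ) • w = circleInversion ((2 : ℝ) • b - √3 • v) ∧
    ∃ τ : ℝ, w = τ • (Complex.I * ((2 : ℝ) • b - √3 • v)) ∧
      τ ^ 2 * ‖(2 : ℝ) • b - √3 • v‖ ^ 2 = cellWidth ((2 : ℝ) • b - √3 • v) := by
  have h3 : √3 ≠ 0 := by positivity
  have h33 : √3 ^ 2 = 3 := Real.sq_sqrt (by norm_num)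
  obtain ⟨x, hx, hx'⟩ := exists_eq_smul_of_norm_sub_eq_norm_add (h := (2 : ℝ) • b - w) hw (by
    rw [sub_add_cancel, norm_smul, hb, show (2 : ℝ) • b - w - w = (2 : ℝ) • (b - w) by module,
      norm_smul, hd])
  obtain ⟨y, hy, hy'⟩ := exists_eq_smul_of_norm_sub_eq_norm_add (h := √3 • v - w) hw (by
    rw [sub_add_cancel, norm_smul, hv,
      show √3 • v - w - w = √3 • (v - (2 / √3) • w) by
        rw [smul_sub, smul_smul, mul_div_cancel₀ _ h3]; module,
      norm_smul, hu])
  rw [sub_add_cancel, norm_smul, hb, mul_one, Real.norm_eq_abs, sq_abs] at hx'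
  rw [sub_add_cancel, norm_smul, hv, mul_one, Real.norm_eq_abs, sq_abs, h33] at hy'
  have hc : (2 : ℝ) • b - √3 • v = (x - y) • (Complex.I * w) := by
    rw [sub_smul, ← hx, ← hy]; abel
  have ha : (2 : ℝ) • b + √3 • v - (2 : ℝ) • w = (x + y) • (Complex.I * w) := by
    rw [add_smul, ← hx, ← hy]; module
  -- The difference of the two Pythagorean relations.
  have hxy : (x + y) * (x - y) * ‖w‖ ^ 2 = 1 := by linarith
  have hxy0 : x - y ≠ 0 := by
    intro h; simp [h] at hxy
  have hW : ‖w‖ ≠ 0 := norm_ne_zero_iff.2 hw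
  have hR : ‖(2 : ℝ) • b - √3 • v‖ ^ 2 = (x - y) ^ 2 * ‖w‖ ^ 2 := by
    rw [hc, norm_smul, norm_mul, Complex.norm_I, one_mul, mul_pow, Real.norm_eq_abs, sq_abs]
  have hplus : x + y = ((x - y) ^ 2 * ‖w‖ ^ 2)⁻¹ * (x - y) := by
    field_simp
    linear_combination hxy
  refine ⟨?_, ?_, ?_⟩
  · rw [hc]
    exact smul_ne_zero hxy0 (mul_ne_zero Complex.I_ne_zero hw)
  · rw [ha, circleInversion, hR, hc, smul_smul, ← hplus]
  · refine ⟨-(x - y)⁻¹, ?_, ?_⟩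
    · rw [hc, mul_smul_comm, ← mul_assoc, Complex.I_mul_I, smul_smul, neg_mul,
        inv_mul_cancel₀ hxy0]
      simp
    · rw [cellWidth, hR]
      have h5 : ((x - y) ^ 2 * ‖w‖ ^ 2)⁻¹ = (x + y) ^ 2 * ‖w‖ ^ 2 := by
        rw [hplus]; field_simp
      have h6 : (-(x - y)⁻¹) ^ 2 * ((x - y) ^ 2 * ‖w‖ ^ 2) = ‖w‖ ^ 2 := by field_simp
      rw [h5, h6]
      linarith

/-- `cellWidth c` is `‖w‖ ^ 2`. Strictly between 1 and 9, the half diagonal `w` is reached by the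
tether, a chain of bars of lengths 2 and 1, in exactly two distinct ways. -/
theorem cellWidth_mem {c : ℂ} (h1 : 1 / 2 ≤ ‖c‖) (h2 : ‖c‖ ≤ 2) :
    1 < cellWidth c ∧ cellWidth c < 9 := by
  have h3 : 0 < ‖c‖ := by linarith
  set R := ‖c‖ ^ 2 with hR
  have hR1 : 1 / 4 ≤ R := by rw [hR]; nlinarith
  have hR2 : R ≤ 4 := by rw [hR]; nlinarith
  have hR0 : 0 < R := by linarith
  have hi : R⁻¹ ≤ 4 := by
    rw [inv_le_comm₀ hR0 (by norm_num)]; linarith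
  have hi0 : 0 < R⁻¹ := inv_pos.2 hR0
  rw [cellWidth, ← hR]
  constructor <;> linarith

/-- The coefficients of `s` with respect to `w` and `i w` in `w = 2 s + t`, when `s` and `t` are unit
vectors. -/
noncomputable def tetherRe (W : ℝ) : ℝ := (W + 3) / (4 * W)

noncomputable def tetherIm (W : ℝ) : ℝ := √(W⁻¹ - tetherRe W ^ 2)

theorem tether_pos {W : ℝ} (h1 : 1 < W) (h9 : W < 9) : 0 < W⁻¹ - tetherRe W ^ 2 := by
  have h0 : 0 < W := by linarith
  have : W⁻¹ - tetherRe W ^ 2 = ((W - 1) * (9 - W)) / (16 * W ^ 2) := by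
    rw [tetherRe]; field_simp; ring
  rw [this]
  have : 0 < W - 1 := by linarith
  have : 0 < 9 - W := by linarith
  positivity

theorem norm_smul_add_smul_I (α β : ℝ) (w : ℂ) :
    ‖α • w + β • (Complex.I * w)‖ ^ 2 = (α ^ 2 + β ^ 2) * ‖w‖ ^ 2 := by
  simp only [Complex.sq_norm, Complex.normSq_apply, Complex.add_re, Complex.add_im,
    Complex.real_smul, Complex.mul_re, Complex.mul_im, Complex.ofReal_re,
    Complex.ofReal_im, Complex.I_re, Complex.I_im]
  ring

theorem exists_eq_smul_add_smul_I {w : ℂ} (hw : w ≠ 0) (s : ℂ) :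
    ∃ α β : ℝ, s = α • w + β • (Complex.I * w) := by
  refine ⟨(s / w).re, (s / w).im, ?_⟩
  calc s = s / w * w := (div_mul_cancel₀ s hw).symm
    _ = ((s / w).re + (s / w).im * Complex.I) * w := by rw [Complex.re_add_im]
    _ = _ := by rw [Complex.real_smul, Complex.real_smul]; ring

/-- Unequal bar lengths keep the end of the chain away from `0`, which rules out the degenerate
cells. In the basis `w`, `i w`, the two unit conditions determine the first coefficient of `s` and
the square of the second. -/
theorem tether_unique {s t : ℂ} (hs : ‖s‖ = 1) (ht : ‖t‖ = 1) :
    2 * s + t ≠ 0 ∧ ∃ ε : ℤˣ, s = tetherRe (‖2 * s + t‖ ^ 2) • (2 * s + t) +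
      ((ε : ℝ) * tetherIm (‖2 * s + t‖ ^ 2)) • (Complex.I * (2 * s + t)) := by
  have hw : 2 * s + t ≠ 0 := by
    intro h
    have : t = -(2 * s) := by linear_combination h
    rw [this, norm_neg, norm_mul, hs] at ht
    norm_num at ht
  refine ⟨hw, ?_⟩
  obtain ⟨α, β, hαβ⟩ := exists_eq_smul_add_smul_I hw s
  have htw : t = (1 - 2 * α) • (2 * s + t) + (-(2 * β)) • (Complex.I * (2 * s + t)) := by
    have : t = (2 * s + t) - (2 : ℝ) • s := by simp
    nth_rw 1 [this]
    nth_rw 2 [hαβ]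
    module
  generalize 2 * s + t = w at *
  have h1 := norm_smul_add_smul_I α β w
  have h2 := norm_smul_add_smul_I (1 - 2 * α) (-(2 * β)) w
  rw [← hαβ, hs] at h1
  rw [← htw, ht] at h2
  have hW : ‖w‖ ^ 2 ≠ 0 := by simpa using hw
  set W := ‖w‖ ^ 2
  have hα : α = tetherRe W := by
    rw [tetherRe]
    field_simp
    linear_combination h2 - 4 * h1
  have hβ : β ^ 2 = W⁻¹ - tetherRe W ^ 2 := by
    rw [← hα]
    field_simp
    linear_combination -h1
  have hβ' : |β| = tetherIm W := by
    rw [tetherIm, ← hβ, Real.sqrt_sq_eq_abs]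
  rcases abs_choice β with h | h
  · exact ⟨1, by rw [← hβ', h, ← hα, hαβ]; simp⟩
  · exact ⟨-1, by rw [← hβ', h, ← hα, hαβ]; simp⟩

theorem tether_exists {w s : ℂ} {ε : ℤˣ} (h1 : 1 < ‖w‖ ^ 2) (h9 : ‖w‖ ^ 2 < 9)
    (hs : s = tetherRe (‖w‖ ^ 2) • w + ((ε : ℝ) * tetherIm (‖w‖ ^ 2)) • (Complex.I * w)) :
    ‖s‖ = 1 ∧ ‖w - (2 : ℝ) • s‖ = 1 := by
  have ht : w - (2 : ℝ) • s = (1 - 2 * tetherRe (‖w‖ ^ 2)) • w +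
      (-(2 * ((ε : ℝ) * tetherIm (‖w‖ ^ 2)))) • (Complex.I * w) := by
    rw [hs]; module
  have hε : (ε : ℝ) ^ 2 = 1 := by
    rcases Int.units_eq_one_or ε with rfl | rfl <;> simp
  have e1 := norm_smul_add_smul_I (tetherRe (‖w‖ ^ 2)) ((ε : ℝ) * tetherIm (‖w‖ ^ 2)) w
  have e2 := norm_smul_add_smul_I (1 - 2 * tetherRe (‖w‖ ^ 2))
    (-(2 * ((ε : ℝ) * tetherIm (‖w‖ ^ 2)))) w
  rw [← hs] at e1
  rw [← ht] at e2
  set W := ‖w‖ ^ 2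
  have hb : tetherIm W ^ 2 = W⁻¹ - tetherRe W ^ 2 := Real.sq_sqrt (tether_pos h1 h9).le
  have hW : W ≠ 0 := by linarith
  constructor
  · rw [← sq_eq_sq₀ (norm_nonneg _) zero_le_one, e1, mul_pow, hε, hb, tetherRe]
    field_simp
    ring
  · rw [← sq_eq_sq₀ (norm_nonneg _) zero_le_one, e2, neg_sq, mul_pow, mul_pow, hε, hb, tetherRe]
    field_simp
    ring

theorem circleInversion_ne_zero {c : ℂ} (hc : c ≠ 0) : circleInversion c ≠ 0 :=
  smul_ne_zero (by simpa using hc) hc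

theorem norm_circleInversion (c : ℂ) : ‖circleInversion c‖ = ‖c‖⁻¹ := by
  rw [circleInversion, norm_smul, norm_inv, norm_pow, norm_norm]
  by_cases h : ‖c‖ = 0
  · simp [h]
  · field_simp

theorem circleInversion_circleInversion (c : ℂ) : circleInversion (circleInversion c) = c := by
  by_cases hc : c = 0
  · simp [hc, circleInversion]
  · have : ‖c‖ ≠ 0 := norm_ne_zero_iff.2 hc
    rw [circleInversion, norm_circleInversion, circleInversion, smul_smul]
    have : (‖c‖⁻¹ ^ 2)⁻¹ * (‖c‖ ^ 2)⁻¹ = 1 := by field_simp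
    rw [this, one_smul]

theorem contDiffAt_circleInversion {c : ℂ} (hc : c ≠ 0) : ContDiffAt ℝ ω circleInversion c := by
  have h : ‖c‖ ^ 2 ≠ 0 := by simpa using hc
  exact ((contDiff_norm_sq ℝ).contDiffAt.inv h).smul contDiffAt_id

/-- The positions of the half diagonal and of the four unit vectors of a Peaucellier cell. -/
noncomputable def cellDiagonal (ε : ℤˣ) (c : ℂ) : ℂ :=
  ((ε : ℝ) * √(cellWidth c / ‖c‖ ^ 2)) • (Complex.I * c)

noncomputable def cellSection (ε : ℤˣ × ℤˣ) (c : ℂ) : (ℂ × ℂ) × (ℂ × ℂ) :=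
  let w := cellDiagonal ε.1 c
  let s := tetherRe (cellWidth c) • w + ((ε.2 : ℝ) * tetherIm (cellWidth c)) • (Complex.I * w)
  (((1 / 4 : ℝ) • (circleInversion c + c + (2 : ℝ) • w),
    (√3)⁻¹ • (1 / 2 : ℝ) • (circleInversion c - c + (2 : ℝ) • w)), (s, w - (2 : ℝ) • s))

theorem norm_sq_cellDiagonal {ε : ℤˣ} {c : ℂ} (hc : c ≠ 0) (hW : 0 ≤ cellWidth c) :
    ‖cellDiagonal ε c‖ ^ 2 = cellWidth c := by
  have hε : (ε : ℝ) ^ 2 = 1 := by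
    rcases Int.units_eq_one_or ε with rfl | rfl <;> simp
  have hR : ‖c‖ ≠ 0 := norm_ne_zero_iff.2 hc
  rw [cellDiagonal, norm_smul, norm_mul Complex.I, Complex.norm_I, one_mul, mul_pow, Real.norm_eq_abs,
    sq_abs, mul_pow, hε, Real.sq_sqrt (by positivity)]
  field_simp

theorem contDiffAt_cellSection (ε : ℤˣ × ℤˣ) {c : ℂ} (h1 : 1 / 2 ≤ ‖c‖) (h2 : ‖c‖ ≤ 2) :
    ContDiffAt ℝ ω (cellSection ε) c := by
  have hc : c ≠ 0 := norm_pos_iff.1 (by linarith)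
  have hR : ‖c‖ ^ 2 ≠ 0 := by simpa using hc
  obtain ⟨hW1, hW9⟩ := cellWidth_mem h1 h2
  have hi := contDiffAt_circleInversion hc
  have hn : ContDiffAt ℝ ω (fun c : ℂ => ‖c‖ ^ 2) c := (contDiff_norm_sq ℝ).contDiffAt
  have hW : ContDiffAt ℝ ω cellWidth c :=
    contDiffAt_const.sub (((hn.add contDiffAt_const).add (hn.inv hR)).div_const _)
  have hI : ContDiffAt ℝ ω (fun c : ℂ => Complex.I * c) c := contDiffAt_const.mul contDiffAt_id
  have hw : ContDiffAt ℝ ω (cellDiagonal ε.1) c :=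
    (contDiffAt_const.mul ((hW.div hn hR).sqrt (div_ne_zero (by linarith) hR))).smul hI
  have hα : ContDiffAt ℝ ω (fun c => tetherRe (cellWidth c)) c :=
    (hW.add contDiffAt_const).div (contDiffAt_const.mul hW)
      (mul_ne_zero four_ne_zero (by linarith))
  have hβ : ContDiffAt ℝ ω (fun c => tetherIm (cellWidth c)) c :=
    ((hW.inv (by linarith)).sub (hα.pow 2)).sqrt (tether_pos hW1 hW9).ne'
  have hs := (hα.smul hw).add (((contDiffAt_const (c := (ε.2 : ℝ))).mul hβ).smul
    ((contDiffAt_const (c := Complex.I)).mul hw))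
  exact ((((hi.add contDiffAt_id).add (hw.const_smul (2 : ℝ))).const_smul _).prodMk
    ((((hi.sub contDiffAt_id).add (hw.const_smul (2 : ℝ))).const_smul _).const_smul _)).prodMk
    (hs.prodMk (hw.sub (hs.const_smul _)))

/-- The configurations of a Peaucellier cell with a tether. -/
def cellConfig : Set ((ℂ × ℂ) × (ℂ × ℂ)) :=
  {x | ‖x.1.1‖ = 1 ∧ ‖x.1.2‖ = 1 ∧ ‖x.2.1‖ = 1 ∧ ‖x.2.2‖ = 1 ∧
    ‖x.1.1 - (2 * x.2.1 + x.2.2)‖ = 1 ∧ ‖x.1.2 - (2 / √3) • (2 * x.2.1 + x.2.2)‖ = 1}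

noncomputable def cellInput (x : (ℂ × ℂ) × (ℂ × ℂ)) : ℂ := (2 : ℝ) • x.1.1 - √3 • x.1.2

theorem cellInput_cellSection (ε : ℤˣ × ℤˣ) (c : ℂ) : cellInput (cellSection ε c) = c := by
  have h3 : √3 ≠ 0 := by positivity
  rw [cellInput, cellSection]
  simp only [smul_inv_smul₀ h3]
  module

theorem cellSection_mem (ε : ℤˣ × ℤˣ) {c : ℂ} (h1 : 1 / 2 ≤ ‖c‖) (h2 : ‖c‖ ≤ 2) :
    cellSection ε c ∈ cellConfig := by
  have hc : c ≠ 0 := norm_pos_iff.1 (by linarith)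
  have hR : ‖c‖ ≠ 0 := norm_ne_zero_iff.2 hc
  have h33 : √3 ^ 2 = 3 := Real.sq_sqrt (by norm_num)
  obtain ⟨hW1, hW9⟩ := cellWidth_mem h1 h2
  have hw := norm_sq_cellDiagonal (ε := ε.1) hc (by linarith)
  obtain ⟨hs, ht⟩ := tether_exists (w := cellDiagonal ε.1 c) (ε := ε.2) (by rw [hw]; exact hW1)
    (by rw [hw]; exact hW9) rfl
  rw [hw] at hs ht
  have hε : (ε.1 : ℝ) ^ 2 = 1 := by
    rcases Int.units_eq_one_or ε.1 with h | h <;> simp [h]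
  -- All four bars `b`, `b - w`, `v`, `v - (2 / √3) w` have this shape, with `y = ±1` and `z = ±2`.
  -- The squared norm of the bracket is `‖c‖⁻² + 2y + ‖c‖² + 4 * cellWidth c = 14 + 2y`, which is 16
  -- or 12.
  have key : ∀ x y z : ℝ, x ^ 2 * (14 + 2 * y) = 1 → y ^ 2 = 1 → z ^ 2 = 4 →
      ‖x • (circleInversion c + y • c + z • cellDiagonal ε.1 c)‖ = 1 := by
    intro x y z hx hy hz
    have : x • (circleInversion c + y • c + z • cellDiagonal ε.1 c) =
        (x * ((‖c‖ ^ 2)⁻¹ + y)) • c +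
          (x * (z * ((ε.1 : ℝ) * √(cellWidth c / ‖c‖ ^ 2)))) • (Complex.I * c) := by
      rw [circleInversion, cellDiagonal]; module
    rw [← sq_eq_sq₀ (norm_nonneg _) zero_le_one, this, norm_smul_add_smul_I, mul_pow, mul_pow,
      mul_pow, mul_pow, hε, Real.sq_sqrt (by positivity), hz]
    have hexp : ((‖c‖ ^ 2)⁻¹ + y) ^ 2 = (‖c‖ ^ 2)⁻¹ ^ 2 + 2 * y * (‖c‖ ^ 2)⁻¹ + 1 := by
      rw [← hy]; ring
    rw [hexp]
    have : (x ^ 2 * ((‖c‖ ^ 2)⁻¹ ^ 2 + 2 * y * (‖c‖ ^ 2)⁻¹ + 1) +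
        x ^ 2 * (4 * (1 * (cellWidth c / ‖c‖ ^ 2)))) * ‖c‖ ^ 2 =
        x ^ 2 * ((‖c‖ ^ 2)⁻¹ + 2 * y + ‖c‖ ^ 2 + 4 * cellWidth c) := by
      field_simp
    rw [this, cellWidth, one_pow, ← hx]
    ring
  have h3 : √3 ≠ 0 := by positivity
  have h3' : ((√3)⁻¹ * (1 / 2)) ^ 2 = 1 / 12 := by
    rw [mul_pow, inv_pow, h33]; norm_num
  have hadd : ∀ w s : ℂ, 2 * s + (w - (2 : ℝ) • s) = w := by
    intro w s
    rw [Complex.real_smul]; push_cast; ring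
  simp only [cellConfig, cellSection, mem_ofPred_eq, hadd]
  have e1 := key (1 / 4) 1 2 (by norm_num) (by norm_num) (by norm_num)
  have e2 := key (1 / 4) 1 (-2) (by norm_num) (by norm_num) (by norm_num)
  have e3 := key ((√3)⁻¹ * (1 / 2)) (-1) 2 (by rw [h3']; norm_num) (by norm_num) (by norm_num)
  have e4 := key ((√3)⁻¹ * (1 / 2)) (-1) (-2) (by rw [h3']; norm_num) (by norm_num) (by norm_num)
  refine ⟨?_, ?_, hs, ht, ?_, ?_⟩
  · refine (congrArg norm ?_).trans e1; module
  · refine (congrArg norm ?_).trans e3; module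
  · refine (congrArg norm ?_).trans e2; module
  · rw [div_eq_mul_inv]; refine (congrArg norm ?_).trans e4; module

/-- The input `c` determines the inverse point and `‖w‖`, hence `w` up to sign on the line `ℝ i c`,
then `s` up to reflection in `w`; `b` and `v` follow linearly. This holds for every configuration,
not only those with input in the annulus. -/
theorem cellSection_complete {x : (ℂ × ℂ) × (ℂ × ℂ)} (hx : x ∈ cellConfig) :
    cellInput x ≠ 0 ∧
      (2 : ℝ) • x.1.1 + √3 • x.1.2 - (2 : ℝ) • (2 * x.2.1 + x.2.2) = circleInversion (cellInput x) ∧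
      ∃ ε, cellSection ε (cellInput x) = x := by
  obtain ⟨⟨b, v⟩, ⟨s, t⟩⟩ := x
  obtain ⟨hb, hv, hs, ht, hd, hu⟩ := hx
  simp only at hb hv hs ht hd hu
  obtain ⟨hw, ε', hε'⟩ := tether_unique hs ht
  obtain ⟨hc, ha, τ, hτ, hτ'⟩ := peaucellier_cell hb hv hw hd hu
  refine ⟨hc, ha, ?_⟩
  simp only [cellInput]
  have h3 : √3 ≠ 0 := by positivity
  have ht' : t = 2 * s + t - (2 : ℝ) • s := by simp
  have hb' : b = (1 / 4 : ℝ) • (circleInversion ((2 : ℝ) • b - √3 • v) +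
      ((2 : ℝ) • b - √3 • v) + (2 : ℝ) • (2 * s + t)) := by
    rw [← ha]; module
  have hv' : v = (√3)⁻¹ • (1 / 2 : ℝ) • (circleInversion ((2 : ℝ) • b - √3 • v) -
      ((2 : ℝ) • b - √3 • v) + (2 : ℝ) • (2 * s + t)) := by
    rw [← ha, eq_inv_smul_iff₀ h3]; module
  generalize (2 : ℝ) • b - √3 • v = c at *
  have hR : ‖c‖ ^ 2 ≠ 0 := by simpa using hc
  have habs : |τ| = √(cellWidth c / ‖c‖ ^ 2) := by
    rw [← hτ', mul_div_cancel_right₀ _ hR, Real.sqrt_sq_eq_abs]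
  have hW : ‖2 * s + t‖ ^ 2 = cellWidth c := by
    rw [hτ, norm_smul, norm_mul, Complex.norm_I, one_mul, mul_pow, Real.norm_eq_abs, sq_abs, hτ']
  rw [hW] at hε'
  have hdiag : ∃ ε, 2 * s + t = cellDiagonal ε c := by
    rcases abs_choice τ with h | h
    · exact ⟨1, by rw [cellDiagonal, ← habs, h, hτ]; simp⟩
    · exact ⟨-1, by rw [cellDiagonal, ← habs, h, hτ]; simp⟩
  obtain ⟨ε, hε⟩ := hdiag
  refine ⟨(ε, ε'), ?_⟩
  rw [hε] at hb' hv' hε' ht'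
  rw [cellSection]
  simp only
  rw [← hε', ← hb', ← hv', ← ht']

/-- In the annulus neither `w` nor the component of `s` along `i w` vanishes, so both signs can be
read off. -/
theorem cellSection_injective {c : ℂ} (h1 : 1 / 2 ≤ ‖c‖) (h2 : ‖c‖ ≤ 2) :
    Function.Injective fun ε => cellSection ε c := by
  have hc : c ≠ 0 := norm_pos_iff.1 (by linarith)
  have hR : 0 < ‖c‖ := norm_pos_iff.2 hc
  obtain ⟨hW1, hW9⟩ := cellWidth_mem h1 h2
  have hIc : Complex.I * c ≠ 0 := mul_ne_zero Complex.I_ne_zero hc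
  have hcast : Function.Injective fun ε : ℤˣ => (ε : ℝ) := fun ε ε' h => by
    simpa [Units.ext_iff] using h
  rintro ⟨ε, δ⟩ ⟨ε', δ'⟩ h
  have hs := congrArg (fun x => x.2.1) h
  have hw := congrArg (fun x => x.2.2 + (2 : ℝ) • x.2.1) h
  simp only [cellSection, sub_add_cancel] at hs hw
  have hε : ε = ε' := by
    apply hcast
    have := smul_left_injective ℝ hIc hw
    refine mul_right_cancel₀ ?_ this
    have : 0 < cellWidth c := by linarith
    positivity
  subst hε
  have hδ : δ = δ' := by
    apply hcast
    have hw0 : Complex.I * cellDiagonal ε c ≠ 0 := by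
      refine mul_ne_zero Complex.I_ne_zero fun h0 => ?_
      have := norm_sq_cellDiagonal (ε := ε) hc (by linarith)
      rw [h0, norm_zero] at this
      norm_num at this
      linarith
    have := smul_left_injective ℝ hw0 (add_left_cancel hs)
    exact mul_right_cancel₀ (Real.sqrt_ne_zero'.2 (tether_pos hW1 hW9)) this
  rw [hδ]

theorem realizes_circleInversion {E : Type*} [NormedAddCommGroup E] [InnerProductSpace ℝ E]
    [FiniteDimensional ℝ E] (κ : ℂ →ₗᵢ[ℝ] E) :
    Realizes {c : ℂ | c ≠ 0} {c : ℂ | 1 / 2 ≤ ‖c‖ ∧ ‖c‖ ≤ 2}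
      {fun c => κ c, fun c => κ (circleInversion c)} := by
  have h := ((realizes_circle κ).prod (realizes_circle κ)).prod
    ((realizes_circle κ).prod (realizes_circle κ))
  replace h := h.subset (𝒢' := {fun x => κ x.1.1, fun x => κ x.1.2, fun x => κ x.2.1,
    fun x => κ x.2.2}) (by
      rintro _ (rfl | rfl | rfl | rfl) <;> apply Submodule.subset_span <;> simp)
  have m : ∀ g ∈ ({fun x => κ x.1.1, fun x => κ x.1.2, fun x => κ x.2.1,
      fun x => κ x.2.2} : Set ((ℂ × ℂ) × (ℂ × ℂ) → E)), g ∈ Submodule.span ℝ _ :=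
    fun g hg => Submodule.subset_span hg
  simp only [forall_mem_insert, mem_singleton_iff, forall_eq] at m
  obtain ⟨mb, mv, ms, mt⟩ := m
  have mw := Submodule.add_mem _ (Submodule.smul_mem _ (2 : ℝ) ms) mt
  replace h := (h.unit (Submodule.sub_mem _ mb mw) 0).subset (𝒢' := {fun x => κ x.1.1,
    fun x => κ x.1.2, fun x => κ x.2.1, fun x => κ x.2.2})
    fun g hg => Submodule.subset_span (mem_insert_of_mem _ hg)
  replace h := (h.unit (Submodule.sub_mem _ mv (Submodule.smul_mem _ (2 / √3) mw)) 0).subset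
    (𝒢' := {fun x => κ x.1.1, fun x => κ x.1.2, fun x => κ x.2.1, fun x => κ x.2.2})
    fun g hg => Submodule.subset_span (mem_insert_of_mem _ hg)
  -- Four planar circles for `b`, `v`, `s`, `t`, with the two remaining bars imposed through
  -- `Realizes.unit`, are exactly the tethered cells.
  have hset : ({z : ℂ | ‖z‖ = 1} ×ˢ {z : ℂ | ‖z‖ = 1}) ×ˢ ({z : ℂ | ‖z‖ = 1} ×ˢ {z : ℂ | ‖z‖ = 1}) ∩
      {x | ‖((fun x => κ x.1.1) - ((2 : ℝ) • (fun x => κ x.2.1) + fun x => κ x.2.2) :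
        (ℂ × ℂ) × (ℂ × ℂ) → E) x - 0‖ = 1} ∩
      {x | ‖((fun x => κ x.1.2) - (2 / √3) • ((2 : ℝ) • (fun x => κ x.2.1) + fun x => κ x.2.2) :
        (ℂ × ℂ) × (ℂ × ℂ) → E) x - 0‖ = 1} = cellConfig := by
    have e1 : ∀ b s t : ℂ, ‖κ b - ((2 : ℝ) • κ s + κ t)‖ = ‖b - (2 * s + t)‖ := by
      intro b s t
      rw [← κ.norm_map, map_sub, map_add, ← map_smul, Complex.real_smul, Complex.ofReal_ofNat]
    have e2 : ∀ b s t : ℂ, ‖κ b - (2 / √3) • ((2 : ℝ) • κ s + κ t)‖ =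
        ‖b - (2 / √3) • (2 * s + t)‖ := by
      intro b s t
      rw [← κ.norm_map, map_sub, map_smul, map_add, ← map_smul, Complex.real_smul,
        Complex.ofReal_ofNat]
    ext x
    simp only [cellConfig, mem_inter_iff, mem_prod, mem_ofPred_eq, sub_zero, Pi.sub_apply,
      Pi.add_apply, Pi.smul_apply, e1, e2]
    tauto
  rw [hset] at h
  refine h.reparam (a := cellInput) (b := cellSection) ?_ ?_ ⟨?_, ?_, ?_, ?_, ?_⟩ ?_ ?_
  · intro x _
    have : ContDiff ℝ ω cellInput := by unfold cellInput; fun_prop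
    exact this.contDiffAt.analyticAt
  · exact fun x hx => (cellSection_complete hx).1
  · exact fun ε c hc => (contDiffAt_cellSection ε hc.1 hc.2).analyticAt
  · exact fun ε c hc => cellSection_mem ε hc.1 hc.2
  · exact fun ε c _ => cellInput_cellSection ε c
  · exact fun x hx _ => (cellSection_complete hx).2.2
  · exact fun c hc => cellSection_injective hc.1 hc.2
  · exact fun ε c hc => cellSection_mem ε hc.1 hc.2
  · rintro _ (rfl | rfl)
    · refine ⟨_, Submodule.sub_mem _ (Submodule.smul_mem _ (2 : ℝ) mb)
        (Submodule.smul_mem _ (√3) mv), fun x _ => ?_⟩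
      simp only [cellInput, map_sub, map_smul, Pi.sub_apply, Pi.smul_apply]
    · refine ⟨_, Submodule.sub_mem _ (Submodule.add_mem _ (Submodule.smul_mem _ (2 : ℝ) mb)
        (Submodule.smul_mem _ (√3) mv)) (Submodule.smul_mem _ (2 : ℝ) mw), fun x hx => ?_⟩
      simp only [← (cellSection_complete hx).2.1]
      simp only [map_sub, map_add, map_smul, Pi.sub_apply, Pi.add_apply, Pi.smul_apply,
        ← Complex.ofReal_ofNat, ← Complex.real_smul]

/-! ### Coupling systems -/

section

variable {E V V' : Type*} [NormedAddCommGroup E] [NormedSpace ℝ E] [NormedAddCommGroup V]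
  [NormedSpace ℝ V] [NormedAddCommGroup V'] [NormedSpace ℝ V'] {Z D : Set V} {𝒢 : Set (V → E)}

theorem Realizes.dom_subset (h : Realizes Z D 𝒢) : D ⊆ Z := by
  obtain ⟨ι, _, S, r, Φ, _, ⟨i⟩, s, hS, hr, hrZ, hc, hs⟩ := h
  exact fun x hx => hs.right_inv i x hx ▸ hrZ (hs.mem i x hx)

theorem Realizes.insert_span (h : Realizes Z D 𝒢) {g : V → E} (hg : g ∈ Submodule.span ℝ 𝒢) :
    Realizes Z D (insert g 𝒢) :=
  h.subset (insert_subset hg Submodule.subset_span)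

/-- A bar equal to `0 - (-e)`: its length condition is vacuous. -/
theorem Realizes.const (h : Realizes Z D 𝒢) {e : E} (he : ‖e‖ = 1) :
    Realizes Z D (insert (fun _ => e) 𝒢) := by
  have := h.unit (Submodule.zero_mem _) (-e)
  simpa [he] using this

/-- Attach a second system, whose parameter is determined by the parameter of the first. -/
theorem Realizes.extend {Z' D' : Set V'} {𝒢' : Set (V' → E)} (h : Realizes Z D 𝒢)
    (h' : Realizes Z' D' 𝒢') {z : V → E} {g : V' → E} (hz : z ∈ 𝒢)
    (hg : g ∈ Submodule.span ℝ 𝒢') {b : V → V'} (hb : AnalyticOnNhd ℝ b D)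
    (huniq : ∀ x ∈ Z, ∀ y ∈ Z', z x = g y → y = b x) (hbD : MapsTo b D D')
    (hzg : ∀ x ∈ D, z x = g (b x)) :
    Realizes (Z ∩ b ⁻¹' Z') D (𝒢 ∪ (fun g' x => g' (b x)) '' 𝒢') := by
  have hDZ := h.dom_subset
  have hDZ' := h'.dom_subset
  have h1 := (h.prod (h'.insert_span hg)).insert_span
    (g := fun x => z x.1 - g x.2) (Submodule.sub_mem _
      (Submodule.subset_span (Or.inl ⟨z, hz, rfl⟩))
      (Submodule.subset_span (Or.inr ⟨g, mem_insert _ _, rfl⟩)))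
  -- Gluing `z x` to `g y` leaves only the graph `y = b x`, by `huniq`; projection to the first
  -- factor then has a single section.
  have h2 := h1.constraint (mem_insert _ _) 0
  refine h2.reparam (a := Prod.fst) (Ψ := Unit) (b := fun _ x => (x, b x)) ?_ ?_
    ⟨?_, ?_, ?_, ?_, ?_⟩ ?_ ?_
  · exact fun x _ => analyticAt_fst
  · rintro ⟨x, y⟩ ⟨⟨hx, hy⟩, hxy⟩
    exact ⟨hx, huniq x hx y hy (sub_eq_zero.1 hxy) ▸ hy⟩
  · exact fun _ x hx => analyticAt_id.prod (hb x hx)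
  · exact fun _ x hx => ⟨⟨hDZ hx, hDZ' (hbD hx)⟩, sub_eq_zero.2 (hzg x hx)⟩
  · exact fun _ _ _ => rfl
  · rintro ⟨x, y⟩ ⟨⟨hx, hy⟩, hxy⟩ _
    exact ⟨(), Prod.ext rfl (huniq x hx y hy (sub_eq_zero.1 hxy)).symm⟩
  · exact fun _ _ _ _ _ => rfl
  · exact fun _ x hx => ⟨⟨hx, hbD hx⟩, sub_eq_zero.2 (hzg x hx)⟩
  · rintro _ (hk | ⟨k, hk, rfl⟩)
    · exact ⟨_, Submodule.subset_span (Or.inr (Or.inl ⟨_, hk, rfl⟩)), fun _ _ => rfl⟩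
    · refine ⟨_, Submodule.subset_span (Or.inr (Or.inr ⟨k, Or.inr hk, rfl⟩)), ?_⟩
      rintro ⟨x, y⟩ ⟨⟨hx, hy⟩, hxy⟩
      exact congrArg k (huniq x hx y hy (sub_eq_zero.1 hxy)).symm

theorem realizes_of_subsingleton [Subsingleton V] : Realizes (univ : Set V) univ (∅ : Set (V → E)) := by
  refine ⟨Empty, inferInstance, univ, fun _ => 0, Unit, inferInstance, inferInstance,
    fun _ _ i => i.elim, ⟨∅, finite_empty, by ext; simp⟩, fun _ _ => analyticAt_const,
    fun _ _ => trivial, by simp, ⟨?_, ?_, ?_, ?_, ?_⟩⟩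
  · exact fun _ x _ => analyticAt_pi_iff.2 fun i => i.elim
  · exact fun _ _ _ => trivial
  · exact fun _ x _ => Subsingleton.elim _ _
  · exact fun u _ _ => ⟨(), Subsingleton.elim _ _⟩
  · exact fun _ _ _ _ _ => rfl

end

/-! ### Straight lines and real arithmetic -/

section

variable {E V : Type*} [NormedAddCommGroup E] [InnerProductSpace ℝ E] [FiniteDimensional ℝ E]
  [NormedAddCommGroup V] [NormedSpace ℝ V] {Z D : Set V} {𝒢 : Set (V → E)}

/-- The circle `‖c - 1‖ = 1` passes through the centre of inversion, so its inverse is the line `Re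
= 1/2`. The parameter is the height on that line, scaled by `δ`. -/
theorem realizes_line (κ : ℂ →ₗᵢ[ℝ] E) {δ : ℝ} (hδ : 0 < δ) :
    Realizes univ (Icc (-δ) δ) {fun t : ℝ => t • κ Complex.I} := by
  have h1 := ((realizes_circleInversion κ).const (e := κ 1) (by simp)).unit
    (g := fun c => κ c) (Submodule.subset_span (by simp)) (κ 1)
  have hset : ∀ c : ℂ, c ≠ 0 → (‖κ c - κ 1‖ = 1 ↔ (circleInversion c).re = 1 / 2) := by
    intro c hc
    have h0 : c.re * c.re + c.im * c.im ≠ 0 := by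
      rw [← Complex.normSq_apply]; simpa using hc
    rw [← map_sub, κ.norm_map, ← sq_eq_sq₀ (norm_nonneg _) zero_le_one, circleInversion,
      Complex.smul_re, Complex.sq_norm, Complex.sq_norm, Complex.normSq_apply, Complex.normSq_apply,
      smul_eq_mul, inv_mul_eq_iff_eq_mul₀ h0]
    simp only [Complex.sub_re, Complex.sub_im, Complex.one_re, Complex.one_im]
    constructor <;> intro h <;> linarith
  let p : ℝ → ℂ := fun t => 1 / 2 + (t / δ : ℝ) * Complex.I
  have hpre : ∀ t, (p t).re = 1 / 2 := fun t => by simp [p]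
  have hpim : ∀ t, (p t).im = t / δ := fun t => by simp [p]
  have hp0 : ∀ t, p t ≠ 0 := fun t h => by
    have := hpre t
    rw [h] at this
    norm_num at this
  -- Here `‖p t‖ ^ 2` lies between `1/4` and `5/4`, so the input of the cell stays in its annulus.
  have hpD : ∀ t ∈ Icc (-δ) δ, 1 / 2 ≤ ‖circleInversion (p t)‖ ∧ ‖circleInversion (p t)‖ ≤ 2 := by
    rintro t ⟨ht1, ht2⟩
    have h3 : (t / δ) ^ 2 ≤ 1 := by
      rw [sq_le_one_iff_abs_le_one, abs_div, abs_of_pos hδ, div_le_one hδ]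
      exact abs_le.2 ⟨ht1, ht2⟩
    have h4 : ‖p t‖ ^ 2 = 1 / 4 + (t / δ) ^ 2 := by
      rw [Complex.sq_norm, Complex.normSq_apply, hpre, hpim]; ring
    have h5 : 1 / 2 ≤ ‖p t‖ := by
      nlinarith [norm_nonneg (p t), sq_nonneg (t / δ)]
    have h6 : ‖p t‖ ≤ 2 := by
      nlinarith [norm_nonneg (p t)]
    have h7 : 0 < ‖p t‖ := by linarith
    rw [norm_circleInversion]
    exact ⟨by rw [le_inv_comm₀ (by norm_num) h7]; linarith,
      by rw [inv_le_comm₀ h7 (by norm_num)]; linarith⟩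
  have hanalytic : ∀ {c : ℂ}, c ≠ 0 → AnalyticAt ℝ circleInversion c := fun hc =>
    (contDiffAt_circleInversion hc).analyticAt
  have hp : ContDiff ℝ ω p := by
    have : p = fun t : ℝ => (1 / 2 : ℂ) + (t / δ) • Complex.I := by
      ext t; simp [p]
    rw [this]
    fun_prop
  refine h1.reparam (a := fun c => δ * (circleInversion c).im) (Ψ := Unit)
    (b := fun _ t => circleInversion (p t)) ?_ (fun _ _ => trivial) ⟨?_, ?_, ?_, ?_, ?_⟩ ?_ ?_
  · rintro c ⟨hc, -⟩
    exact analyticAt_const.mul ((Complex.imCLM.analyticAt _).comp (hanalytic hc))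
  · exact fun _ t _ => AnalyticAt.comp (hanalytic (hp0 t)) hp.contDiffAt.analyticAt
  · intro _ t _
    refine ⟨circleInversion_ne_zero (hp0 t), (hset _ (circleInversion_ne_zero (hp0 t))).2 ?_⟩
    rw [circleInversion_circleInversion, hpre]
  · intro _ t _
    simp only [circleInversion_circleInversion, hpim]
    field_simp
  · rintro c ⟨hc, hc1⟩ _
    refine ⟨(), ?_⟩
    have : p (δ * (circleInversion c).im) = circleInversion c := by
      apply Complex.ext
      · rw [hpre]
        exact ((hset c hc).1 hc1).symm
      · rw [hpim]; field_simp
    simp only [this, circleInversion_circleInversion]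
  · exact fun _ _ _ _ _ => rfl
  · intro _ t ht
    refine ⟨hpD t ht, (hset _ (circleInversion_ne_zero (hp0 t))).2 ?_⟩
    rw [circleInversion_circleInversion, hpre]
  · rintro _ rfl
    refine ⟨δ • ((fun c => κ (circleInversion c)) - (1 / 2 : ℝ) • fun _ => κ 1),
      Submodule.smul_mem _ _ (Submodule.sub_mem _ (Submodule.subset_span (by simp))
        (Submodule.smul_mem _ _ (Submodule.subset_span (by simp)))), ?_⟩
    rintro c ⟨hc, hc1⟩
    have h2 := (hset c hc).1 hc1
    have h3 : circleInversion c = (1 / 2 : ℝ) • (1 : ℂ) + (circleInversion c).im • Complex.I := by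
      apply Complex.ext
      · simp [h2]
      · simp
    simp only [Pi.smul_apply, Pi.sub_apply]
    nth_rw 2 [h3]
    rw [map_add, map_smul, map_smul, mul_smul, add_sub_cancel_left]

/-- On the imaginary axis, inversion in the unit circle sends `φ i` to `φ⁻¹ i`. -/
theorem Realizes.inv (κ : ℂ →ₗᵢ[ℝ] E) (h : Realizes Z D 𝒢) {φ : V → ℝ}
    (hφ : (fun x => φ x • κ Complex.I) ∈ 𝒢) (hφa : AnalyticOnNhd ℝ φ D)
    (hφD : ∀ x ∈ D, 1 / 2 ≤ |φ x| ∧ |φ x| ≤ 2) :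
    Realizes (Z ∩ {x | φ x ≠ 0}) D (insert (fun x => (φ x)⁻¹ • κ Complex.I) 𝒢) := by
  have hn : ∀ x, ‖φ x • Complex.I‖ = |φ x| := fun x => by simp
  have h1 := h.extend (realizes_circleInversion κ) hφ
    (Submodule.subset_span (mem_insert _ _)) (b := fun x => φ x • Complex.I)
    (fun x hx => (hφa x hx).smul analyticAt_const)
    (fun x _ y _ hxy => by
      rw [← map_smul] at hxy
      exact κ.injective hxy.symm)
    (fun x hx => by
      change _ ≤ ‖φ x • Complex.I‖ ∧ ‖φ x • Complex.I‖ ≤ 2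
      rw [hn]
      exact hφD x hx)
    (fun x _ => (map_smul κ _ _).symm)
  refine h1.mono ?_ Subset.rfl ?_
  · rintro x ⟨hx, hx'⟩
    refine ⟨hx, fun h0 => hx' ?_⟩
    simp [h0]
  · rintro _ (rfl | hg)
    · refine ⟨_, Submodule.subset_span (Or.inr ⟨_, Or.inr rfl, rfl⟩), fun x _ => ?_⟩
      simp only [circleInversion, hn, sq_abs, smul_smul, ← map_smul]
      congr 2
      by_cases h0 : φ x = 0
      · simp [h0]
      · field_simp
    · exact ⟨_, Submodule.subset_span (Or.inl hg), fun _ _ => rfl⟩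

/-- Squares come from three reciprocals: the mean of `(1 + a)⁻¹` and `(1 - a)⁻¹` is `(1 - a ^ 2)⁻¹`,
and inverting it gives `1 - a ^ 2`. Scaling to `a = η φ` with `|a| ≤ 1/2` on `D` keeps all three
inputs between `1/2` and `2`. -/
theorem Realizes.sq (κ : ℂ →ₗᵢ[ℝ] E) (h : Realizes Z D 𝒢) {φ : V → ℝ}
    (hφ : (fun x => φ x • κ Complex.I) ∈ Submodule.span ℝ 𝒢) (hφa : AnalyticOnNhd ℝ φ D) {M : ℝ}
    (hφD : ∀ x ∈ D, |φ x| ≤ M) :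
    Realizes Z D (insert (fun x => φ x ^ 2 • κ Complex.I) 𝒢) := by
  obtain ⟨η, hη, hηD⟩ : ∃ η : ℝ, 0 < η ∧ ∀ x ∈ D, |η * φ x| ≤ 1 / 2 := by
    refine ⟨(2 * (|M| + 1))⁻¹, by positivity, fun x hx => ?_⟩
    have hM := (hφD x hx).trans (le_abs_self M)
    have : 0 ≤ |M| := abs_nonneg M
    rw [abs_mul, abs_of_pos (by positivity), inv_mul_le_iff₀ (by positivity)]
    linarith
  have hηD' : ∀ x ∈ D, -(1 / 2) ≤ η * φ x ∧ η * φ x ≤ 1 / 2 := fun x hx => abs_le.1 (hηD x hx)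
  have hηa : AnalyticOnNhd ℝ (fun x => η * φ x) D := fun x hx => analyticAt_const.mul (hφa x hx)
  set e := κ Complex.I with he
  have h0 := h.const (e := e) (by simp [he])
  have hc : (fun _ : V => e) ∈ Submodule.span ℝ (insert (fun _ : V => e) 𝒢) :=
    Submodule.subset_span (mem_insert _ _)
  have hφ' := Submodule.span_mono (subset_insert (fun _ : V => e) 𝒢) hφ
  have h1 := (h0.insert_span (g := fun x => (1 + η * φ x) • e) (by
    have := Submodule.add_mem _ hc (Submodule.smul_mem _ η hφ')
    convert this using 1
    ext1 x
    simp only [Pi.add_apply, Pi.smul_apply]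
    module)).inv κ (mem_insert _ _) (fun x hx => analyticAt_const.add (hηa x hx)) (by
      intro x hx
      obtain ⟨h1, h2⟩ := hηD' x hx
      rw [abs_of_pos (by linarith)]
      constructor <;> linarith)
  replace h1 := h1.subset (𝒢' := insert (fun x => (1 + η * φ x)⁻¹ • e) (insert (fun _ => e) 𝒢))
    (by
      refine (insert_subset_insert (subset_insert _ _)).trans Submodule.subset_span)
  have h2 := (h1.insert_span (g := fun x => (1 - η * φ x) • e) (by
    have := Submodule.span_mono (subset_insert (fun x => (1 + η * φ x)⁻¹ • e) _)
      (Submodule.sub_mem _ hc (Submodule.smul_mem _ η hφ'))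
    convert this using 1
    ext1 x
    simp only [Pi.sub_apply, Pi.smul_apply]
    module)).inv κ (mem_insert _ _) (fun x hx => analyticAt_const.sub (hηa x hx)) (by
      intro x hx
      obtain ⟨h1, h2⟩ := hηD' x hx
      rw [abs_of_pos (by linarith)]
      constructor <;> linarith)
  set ψ : V → ℝ := fun x => ((1 + η * φ x)⁻¹ + (1 - η * φ x)⁻¹) / 2 with hψ
  have hψD : ∀ x, 1 + η * φ x ≠ 0 → 1 - η * φ x ≠ 0 → ψ x = (1 - (η * φ x) ^ 2)⁻¹ := by
    intro x h1 h2
    have : 1 - (η * φ x) ^ 2 = (1 + η * φ x) * (1 - η * φ x) := by ring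
    rw [hψ, this]
    field_simp
    ring
  have hne : ∀ x ∈ D, 1 + η * φ x ≠ 0 ∧ 1 - η * φ x ≠ 0 := by
    intro x hx
    obtain ⟨h1, h2⟩ := hηD' x hx
    exact ⟨by linarith, by linarith⟩
  have h3 := (h2.insert_span (g := fun x => ψ x • e) (by
    have hψ' : (fun x => ψ x • e) = (1 / 2 : ℝ) •
        ((fun x => (1 + η * φ x)⁻¹ • e) + fun x => (1 - η * φ x)⁻¹ • e) := by
      ext1 x
      simp only [hψ, Pi.add_apply, Pi.smul_apply]
      module
    rw [hψ']
    exact Submodule.smul_mem _ _ (Submodule.add_mem _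
      (Submodule.subset_span (Or.inr (Or.inr (Or.inl rfl))))
      (Submodule.subset_span (Or.inl rfl))))).inv κ (mem_insert _ _) (fun x hx =>
      (((analyticAt_const.add (hηa x hx)).inv (hne x hx).1).add
        ((analyticAt_const.sub (hηa x hx)).inv (hne x hx).2)).div_const) (by
      intro x hx
      obtain ⟨h1, h2⟩ := hηD' x hx
      rw [hψD x (hne x hx).1 (hne x hx).2]
      have hs : (η * φ x) ^ 2 ≤ 1 / 4 := by nlinarith
      have hs0 : 0 ≤ (η * φ x) ^ 2 := sq_nonneg _
      have hpos : 0 < 1 - (η * φ x) ^ 2 := by linarith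
      rw [abs_of_pos (inv_pos.2 hpos)]
      exact ⟨by rw [le_inv_comm₀ (by norm_num) hpos]; linarith,
        by rw [inv_le_comm₀ hpos (by norm_num)]; linarith⟩)
  refine h3.mono (fun x hx => hx.1.1.1) Subset.rfl ?_
  rintro _ (rfl | hg)
  · refine ⟨(η ^ 2)⁻¹ • ((fun _ => e) - fun x => (ψ x)⁻¹ • e), Submodule.smul_mem _ _
      (Submodule.sub_mem _
        (Submodule.subset_span (Or.inr (Or.inr (Or.inr (Or.inr (Or.inr (Or.inl rfl)))))))
        (Submodule.subset_span (Or.inl rfl))), ?_⟩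
    rintro x ⟨⟨⟨-, hx1⟩, hx2⟩, -⟩
    simp only [Pi.sub_apply, Pi.smul_apply]
    rw [hψD x hx1 hx2, inv_inv]
    have : e - (1 - (η * φ x) ^ 2) • e = (η ^ 2) • (φ x ^ 2) • e := by module
    rw [this, inv_smul_smul₀ (by positivity)]
  · exact ⟨_, Submodule.subset_span (Or.inr (Or.inr (Or.inr (Or.inr (Or.inr (Or.inr hg)))))),
      fun _ _ => rfl⟩

/-- Polarization: `4 φ ψ = (φ + ψ) ^ 2 - (φ - ψ) ^ 2`. -/
theorem Realizes.mul (κ : ℂ →ₗᵢ[ℝ] E) (h : Realizes Z D 𝒢) {φ ψ : V → ℝ}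
    (hφ : (fun x => φ x • κ Complex.I) ∈ 𝒢) (hψ : (fun x => ψ x • κ Complex.I) ∈ 𝒢)
    (hφa : AnalyticOnNhd ℝ φ D) (hψa : AnalyticOnNhd ℝ ψ D) {M M' : ℝ}
    (hφD : ∀ x ∈ D, |φ x| ≤ M) (hψD : ∀ x ∈ D, |ψ x| ≤ M') :
    Realizes Z D (insert (fun x => (φ x * ψ x) • κ Complex.I) 𝒢) := by
  set e := κ Complex.I
  have m1 : (fun x => (φ x + ψ x) • e) ∈ Submodule.span ℝ 𝒢 := by
    have := Submodule.add_mem _ (Submodule.subset_span (R := ℝ) hφ) (Submodule.subset_span hψ)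
    convert this using 1
    ext1 x
    exact add_smul _ _ _
  have m2 : (fun x => (φ x - ψ x) • e) ∈ Submodule.span ℝ 𝒢 := by
    have := Submodule.sub_mem _ (Submodule.subset_span (R := ℝ) hφ) (Submodule.subset_span hψ)
    convert this using 1
    ext1 x
    exact sub_smul _ _ _
  have h1 := h.sq κ m1 (hφa.add hψa) (M := M + M') fun x hx =>
    (abs_add_le _ _).trans (add_le_add (hφD x hx) (hψD x hx))
  have h2 := h1.sq κ (Submodule.span_mono (subset_insert _ _) m2) (hφa.sub hψa) (M := M + M')
    fun x hx => (abs_sub _ _).trans (add_le_add (hφD x hx) (hψD x hx))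
  refine h2.subset (insert_subset ?_ fun g hg => Submodule.subset_span (Or.inr (Or.inr hg)))
  have hmul : (fun x => (φ x * ψ x) • e) = (1 / 4 : ℝ) •
      ((fun x => (φ x + ψ x) ^ 2 • e) - fun x => (φ x - ψ x) ^ 2 • e) := by
    ext1 x
    simp only [Pi.sub_apply, Pi.smul_apply, ← sub_smul, smul_smul]
    congr 1
    ring
  rw [hmul]
  exact Submodule.smul_mem _ _ (Submodule.sub_mem _ (Submodule.subset_span (Or.inr (Or.inl rfl)))
    (Submodule.subset_span (Or.inl rfl)))

end

/-! ### Changing direction, and polynomial maps -/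

section

variable {E : Type*} [NormedAddCommGroup E] [InnerProductSpace ℝ E]

/-- The isometric embedding of `ℂ` which takes `1` and `i` to two given orthonormal vectors. -/
noncomputable def planeEmbedding (e f : E) (he : ‖e‖ = 1) (hf : ‖f‖ = 1) (hef : inner ℝ e f = 0) :
    ℂ →ₗᵢ[ℝ] E where
  toFun z := z.re • e + z.im • f
  map_add' z w := by simp only [Complex.add_re, Complex.add_im]; module
  map_smul' t z := by
    simp only [Complex.smul_re, Complex.smul_im, smul_eq_mul, RingHom.id_apply]; module
  norm_map' z := by
    change ‖z.re • e + z.im • f‖ = ‖z‖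
    rw [← sq_eq_sq₀ (norm_nonneg _) (norm_nonneg _), norm_add_sq_real, norm_smul, norm_smul, he, hf,
      inner_smul_left, inner_smul_right, hef, Complex.sq_norm, Complex.normSq_apply]
    simp
    ring

theorem planeEmbedding_I {e f : E} (he : ‖e‖ = 1) (hf : ‖f‖ = 1) (hef : inner ℝ e f = 0) :
    planeEmbedding e f he hf hef Complex.I = f := by
  change Complex.I.re • e + Complex.I.im • f = f
  simp

variable [FiniteDimensional ℝ E]

/-- The real values `φ` in the direction `e` can be transported to a perpendicular direction `f`. -/
theorem Realizes.rotate {V : Type*} [NormedAddCommGroup V] [NormedSpace ℝ V] {Z D : Set V}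
    {𝒢 : Set (V → E)} (h : Realizes Z D 𝒢) {e f : E} (he : ‖e‖ = 1) (hf : ‖f‖ = 1)
    (hef : inner ℝ e f = 0) {φ : V → ℝ} (hφ : (fun x => φ x • e) ∈ 𝒢) (hφa : AnalyticOnNhd ℝ φ D)
    {M : ℝ} (hM : 0 < M) (hφD : ∀ x ∈ D, |φ x| ≤ M) :
    Realizes Z D (insert (fun x => φ x • f) 𝒢) := by
  have h22 : √2 * √2 = 2 := Real.mul_self_sqrt zero_le_two
  have h20 : √2 ≠ 0 := by positivity
  have hfe : inner ℝ f e = 0 := by rw [real_inner_comm, hef]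
  have hee : inner ℝ e e = 1 := by rw [real_inner_self_eq_norm_sq, he]; norm_num
  have hff : inner ℝ f f = 1 := by rw [real_inner_self_eq_norm_sq, hf]; norm_num
  have hp : ‖(√2)⁻¹ • (e + f)‖ = 1 := by
    rw [← sq_eq_sq₀ (norm_nonneg _) zero_le_one, norm_smul, mul_pow, norm_add_sq_real, he, hf, hef,
      norm_inv, inv_pow, Real.norm_eq_abs, sq_abs, Real.sq_sqrt zero_le_two]
    norm_num
  have hm : ‖(√2)⁻¹ • (e - f)‖ = 1 := by
    rw [← sq_eq_sq₀ (norm_nonneg _) zero_le_one, norm_smul, mul_pow, norm_sub_sq_real, he, hf, hef,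
      norm_inv, inv_pow, Real.norm_eq_abs, sq_abs, Real.sq_sqrt zero_le_two]
    norm_num
  have hpm : inner ℝ ((√2)⁻¹ • (e + f)) ((√2)⁻¹ • (e - f)) = 0 := by
    rw [inner_smul_left, inner_smul_right, inner_add_left, inner_sub_right, inner_sub_right, hee,
      hff, hef, hfe]
    simp
  -- A right isosceles triangle with sides sliding on lines: `φ e = y f + t (e - f) / √2` has the
  -- unique solution `y = φ`, `t = √2 φ`, which explains the second bound `√2 * M`.
  have h1 := realizes_line (planeEmbedding e f he hf hef) hM
  have h2 := realizes_line (planeEmbedding _ _ hp hm hpm) (mul_pos (by positivity : 0 < √2) hM)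
  rw [planeEmbedding_I] at h1 h2
  have h3 := h.extend (h1.prod h2) hφ
    (g := (fun y : ℝ × ℝ => y.1 • f) + fun y : ℝ × ℝ => y.2 • (√2)⁻¹ • (e - f))
    (Submodule.add_mem _ (Submodule.subset_span (Or.inl ⟨_, rfl, rfl⟩))
      (Submodule.subset_span (Or.inr ⟨_, rfl, rfl⟩)))
    (b := fun x => (φ x, √2 * φ x)) (fun x hx => (hφa x hx).prod (analyticAt_const.mul (hφa x hx)))
    (by
      rintro x - ⟨y, t⟩ - hxy
      simp only [Pi.add_apply] at hxy
      have e1 := congrArg (fun z => inner ℝ z e) hxy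
      have e2 := congrArg (fun z => inner ℝ z f) hxy
      simp only [inner_smul_left, inner_add_left, inner_sub_left, hee, hff, hef, hfe,
        RCLike.conj_to_real] at e1 e2
      have e3 : t = √2 * φ x := by rw [← mul_one (φ x), e1]; field_simp; ring
      have e4 : y = φ x := by linarith
      rw [e3, e4])
    (by
      intro x hx
      refine ⟨abs_le.1 (hφD x hx), abs_le.1 ?_⟩
      rw [abs_mul, abs_of_pos (by positivity : 0 < √2)]
      exact mul_le_mul_of_nonneg_left (hφD x hx) (by positivity))
    (by
      intro x _
      simp only [Pi.add_apply, smul_smul]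
      rw [mul_right_comm, mul_inv_cancel₀ h20]
      module)
  refine h3.mono inter_subset_left Subset.rfl ?_
  rintro _ (rfl | hg)
  · exact ⟨_, Submodule.subset_span (Or.inr ⟨_, Or.inl ⟨_, rfl, rfl⟩, rfl⟩), fun _ _ => rfl⟩
  · exact ⟨_, Submodule.subset_span (Or.inl hg), fun _ _ => rfl⟩

theorem realizes_coordinates (κ : ℂ →ₗᵢ[ℝ] E) {δ : ℝ} (hδ : 0 < δ) (N : ℕ) :
    Realizes univ (Set.pi univ fun _ : Fin N => Icc (-δ) δ)
      (range fun (i : Fin N) (x : Fin N → ℝ) => x i • κ Complex.I) := by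
  induction N with
  | zero =>
    refine (realizes_of_subsingleton (V := Fin 0 → ℝ) (E := E)).mono Subset.rfl (subset_univ _) ?_
    rintro _ ⟨i, _⟩
    exact i.elim0
  | succ N ih =>
    refine ((realizes_line κ hδ).prod ih).reparam
      (a := fun x i => Fin.cases (motive := fun _ => ℝ) x.1 x.2 i) (Ψ := Unit)
      (b := fun _ x => (x 0, fun i => x i.succ))
      ?_ (fun _ _ => trivial) ⟨?_, ?_, ?_, ?_, ?_⟩ ?_ ?_
    · intro x _
      refine analyticAt_pi_iff.2 fun i => ?_
      cases i using Fin.cases with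
      | zero => exact analyticAt_fst
      | succ i =>
        simp only [Fin.cases_succ]
        exact analyticAt_pi_iff.1 analyticAt_snd i
    · intro _ x _
      exact ((contDiff_apply ℝ ℝ (0 : Fin (N + 1))).contDiffAt.analyticAt).prod
        (analyticAt_pi_iff.2 fun i => (contDiff_apply ℝ ℝ i.succ).contDiffAt.analyticAt)
    · exact fun _ _ _ => ⟨trivial, trivial⟩
    · intro _ x _
      funext i
      cases i using Fin.cases <;> rfl
    · exact fun x _ _ => ⟨(), rfl⟩
    · exact fun _ _ _ _ _ => rfl
    · exact fun _ x hx => ⟨hx 0 trivial, fun i _ => hx i.succ trivial⟩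
    · rintro _ ⟨i, rfl⟩
      cases i using Fin.cases with
      | zero => exact ⟨_, Submodule.subset_span (Or.inl ⟨_, rfl, rfl⟩), fun _ _ => rfl⟩
      | succ i => exact ⟨_, Submodule.subset_span (Or.inr ⟨_, ⟨i, rfl⟩, rfl⟩), fun _ _ => rfl⟩

theorem exists_bound_eval {N : ℕ} (δ : ℝ) (P : MvPolynomial (Fin N) ℝ) :
    ∃ M, 0 < M ∧ ∀ x ∈ Set.pi univ fun _ : Fin N => Icc (-δ) δ, |MvPolynomial.eval x P| ≤ M := by
  have hK : IsCompact (Set.pi univ fun _ : Fin N => Icc (-δ) δ) :=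
    isCompact_univ_pi fun _ => isCompact_Icc
  obtain ⟨M, hM⟩ := hK.exists_bound_of_continuousOn
    (f := fun x => MvPolynomial.eval x P) (MvPolynomial.continuous_eval P).continuousOn
  exact ⟨|M| + 1, by positivity, fun x hx => (hM x hx).trans (by linarith [le_abs_self M])⟩

/-- Sums are free and products with a variable use `Realizes.mul`; compactness of the cube supplies
the bounds. The set `𝒢` is quantified inside so that the induction can enlarge it. -/
theorem Realizes.eval (κ : ℂ →ₗᵢ[ℝ] E) {N : ℕ} {δ : ℝ} (P : MvPolynomial (Fin N) ℝ) :
    ∀ {𝒢 : Set ((Fin N → ℝ) → E)}, Realizes univ (Set.pi univ fun _ : Fin N => Icc (-δ) δ) 𝒢 →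
      (∀ i : Fin N, (fun x : Fin N → ℝ => x i • κ Complex.I) ∈ 𝒢) →
      Realizes univ (Set.pi univ fun _ : Fin N => Icc (-δ) δ)
        (insert (fun x => MvPolynomial.eval x P • κ Complex.I) 𝒢) := by
  induction P using MvPolynomial.induction_on with
  | C a =>
    intro 𝒢 h _
    refine (h.const (e := κ Complex.I) (by simp)).subset (insert_subset ?_ fun g hg =>
      Submodule.subset_span (Or.inr hg))
    simp only [MvPolynomial.eval_C]
    exact Submodule.smul_mem _ a (Submodule.subset_span (mem_insert (fun _ => κ Complex.I) 𝒢))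
  | add p q hp hq =>
    intro 𝒢 h h𝒢
    refine (hq (hp h h𝒢) fun i => Or.inr (h𝒢 i)).subset (insert_subset ?_ fun g hg =>
      Submodule.subset_span (Or.inr (Or.inr hg)))
    simp only [map_add, add_smul]
    exact Submodule.add_mem _ (Submodule.subset_span (Or.inr (Or.inl rfl)))
      (Submodule.subset_span (Or.inl rfl))
  | mul_X p i hp =>
    intro 𝒢 h h𝒢
    obtain ⟨M, -, hM⟩ := exists_bound_eval δ p
    have h1 := (hp h h𝒢).mul κ (mem_insert _ _) (Or.inr (h𝒢 i))
      ((AnalyticOnNhd.eval_mvPolynomial p).mono (subset_univ _))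
      (fun x _ => (contDiff_apply ℝ ℝ i).contDiffAt.analyticAt) hM
      (M' := δ) (fun x hx => abs_le.2 (hx i trivial))
    simp only [map_mul, MvPolynomial.eval_X]
    exact h1.subset (insert_subset (Submodule.subset_span (mem_insert _ _)) fun g hg =>
      Submodule.subset_span (Or.inr (Or.inr hg)))

theorem Realizes.eval_smul (κ : ℂ →ₗᵢ[ℝ] E) {N : ℕ} {δ : ℝ} (P : MvPolynomial (Fin N) ℝ)
    {𝒢 : Set ((Fin N → ℝ) → E)} (h : Realizes univ (Set.pi univ fun _ : Fin N => Icc (-δ) δ) 𝒢)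
    (h𝒢 : ∀ i : Fin N, (fun x : Fin N → ℝ => x i • κ Complex.I) ∈ 𝒢) {f : E} (hf : ‖f‖ = 1)
    (hκf : κ Complex.I = f ∨ inner ℝ (κ Complex.I) f = 0) :
    Realizes univ (Set.pi univ fun _ : Fin N => Icc (-δ) δ)
      (insert (fun x => MvPolynomial.eval x P • f) 𝒢) := by
  have h1 := h.eval κ P h𝒢
  rcases hκf with rfl | hκf
  · exact h1
  · obtain ⟨M, hM0, hM⟩ := exists_bound_eval δ P
    exact (h1.rotate (by simp) hf hκf (mem_insert _ _)
      ((AnalyticOnNhd.eval_mvPolynomial P).mono (subset_univ _)) hM0 hM).subset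
      (insert_subset (Submodule.subset_span (mem_insert _ _)) fun g hg =>
        Submodule.subset_span (Or.inr (Or.inr hg)))

end

/-- All vector valued polynomial maps can be realized simultaneously over a cube. -/
theorem realizes_polynomial {n : ℕ} (hn : 2 ≤ n) {N : ℕ} {δ : ℝ} (hδ : 0 < δ)
    {𝒢 : Set ((Fin N → ℝ) → EuclideanSpace ℝ (Fin n))} (h𝒢 : 𝒢.Finite)
    (hP : ∀ g ∈ 𝒢, ∀ j, ∃ P : MvPolynomial (Fin N) ℝ, ∀ x, g x j = MvPolynomial.eval x P) :
    Realizes univ (Set.pi univ fun _ : Fin N => Icc (-δ) δ) 𝒢 := by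
  let e : Fin n → EuclideanSpace ℝ (Fin n) := fun j => EuclideanSpace.single j 1
  let i₀ : Fin n := ⟨0, by omega⟩
  let i₁ : Fin n := ⟨1, by omega⟩
  have he : ∀ j, ‖e j‖ = 1 := fun j => by simp [e]
  have hee : ∀ i j, i ≠ j → inner ℝ (e i) (e j) = 0 := fun i j hij => by
    simp [e, EuclideanSpace.inner_single_left, hij]
  have h10 : i₁ ≠ i₀ := by simp [i₀, i₁]
  -- Real arithmetic takes place along `e i₀` in a coordinate plane, whose existence needs `2 ≤ n`;
  -- results are then rotated to the other axes.
  let κ := planeEmbedding (e i₁) (e i₀) (he _) (he _) (hee _ _ h10)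
  have hκ : κ Complex.I = e i₀ := planeEmbedding_I _ _ _
  have hκe : ∀ j, κ Complex.I = e j ∨ inner ℝ (κ Complex.I) (e j) = 0 := by
    intro j
    rw [hκ]
    by_cases h : i₀ = j
    · exact Or.inl (by rw [h])
    · exact Or.inr (hee _ _ h)
  have hvec : ∀ (J : Finset (Fin n)) (P : Fin n → MvPolynomial (Fin N) ℝ)
      {𝒢 : Set ((Fin N → ℝ) → EuclideanSpace ℝ (Fin n))},
      Realizes univ (Set.pi univ fun _ : Fin N => Icc (-δ) δ) 𝒢 →
      (∀ i : Fin N, (fun x : Fin N → ℝ => x i • κ Complex.I) ∈ 𝒢) →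
      Realizes univ (Set.pi univ fun _ : Fin N => Icc (-δ) δ)
        (insert (fun x => ∑ j ∈ J, MvPolynomial.eval x (P j) • e j) 𝒢) := by
    intro J P 𝒢 h h𝒢
    induction J using Finset.induction_on with
    | empty =>
      refine h.subset (insert_subset ?_ Submodule.subset_span)
      simp only [Finset.sum_empty]
      exact Submodule.zero_mem _
    | insert j J hj ih =>
      refine (ih.eval_smul κ (P j) (fun i => Or.inr (h𝒢 i)) (he j) (hκe j)).subset
        (insert_subset ?_ fun g hg => Submodule.subset_span (Or.inr (Or.inr hg)))
      simp only [Finset.sum_insert hj]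
      exact Submodule.add_mem _ (Submodule.subset_span (Or.inl rfl))
        (Submodule.subset_span (Or.inr (Or.inl rfl)))
  suffices H : Realizes univ (Set.pi univ fun _ : Fin N => Icc (-δ) δ)
      (𝒢 ∪ range fun (i : Fin N) (x : Fin N → ℝ) => x i • κ Complex.I) from
    H.subset (subset_union_left.trans Submodule.subset_span)
  induction 𝒢, h𝒢 using Set.Finite.induction_on with
  | empty => simpa using realizes_coordinates κ hδ N
  | @insert g 𝒢 _ _ ih =>
    rw [forall_mem_insert] at hP
    choose P hgP using hP.1
    have hg : g = fun x => ∑ j, MvPolynomial.eval x (P j) • e j := by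
      ext x j
      rw [hgP]
      simp [e, Pi.single_apply]
    rw [insert_union, hg]
    exact hvec _ P (ih hP.2) fun i => Or.inr ⟨i, rfl⟩

/-! ### Composing section families with trivial coverings -/

theorem isAnalyticMapOn_of_pieces {E G ι : Type*} [NormedAddCommGroup E] [NormedSpace ℝ E]
    [NormedAddCommGroup G] [NormedSpace ℝ G] {g : E → G} {A : Set E} {O : ι → Set E}
    (hO : ∀ i, IsOpen (O i)) (hd : Pairwise fun i j => Disjoint (O i) (O j)) (hA : A ⊆ ⋃ i, O i)
    (h : ι → E → G) (ha : ∀ i, ∀ x ∈ A ∩ O i, AnalyticAt ℝ (h i) x ∧ g x = h i x) :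
    IsAnalyticMapOn g A := by
  classical
  let H : E → G := fun x => if hx : ∃ i, x ∈ O i then h hx.choose x else g x
  have hH : ∀ i, ∀ x ∈ O i, H x = h i x := by
    intro i x hx
    have hex : ∃ i, x ∈ O i := ⟨i, hx⟩
    have : hex.choose = i := by
      by_contra hne
      exact disjoint_left.1 (hd hne) hex.choose_spec hx
    simp only [H, hex, dif_pos, this]
  refine ⟨H, fun x hx => ?_, fun x hx => ?_⟩
  · obtain ⟨i, hi⟩ := mem_iUnion.1 (hA hx)
    refine (ha i x ⟨hx, hi⟩).1.congr ?_
    filter_upwards [(hO i).mem_nhds hi] with y hy using (hH i y hy).symm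
  · obtain ⟨i, hi⟩ := mem_iUnion.1 (hA hx)
    rw [hH i x hi, (ha i x ⟨hx, hi⟩).2]

/-- The open Voronoi cells of the sets `K i` do the job. -/
theorem exists_disjoint_open_nhds {E ι : Type*} [PseudoEMetricSpace E] [Finite ι] {K : ι → Set E}
    (hK : ∀ i, IsClosed (K i)) (hd : Pairwise fun i j => Disjoint (K i) (K j)) :
    ∃ O : ι → Set E, (∀ i, IsOpen (O i)) ∧ (Pairwise fun i j => Disjoint (O i) (O j)) ∧
      ∀ i, K i ⊆ O i := by
  refine ⟨fun i => ⋂ j, ⋂ (_ : i ≠ j), {x | Metric.infEDist x (K i) < Metric.infEDist x (K j)},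
    fun i => ?_, fun i j hij => ?_, fun i x hx => ?_⟩
  · exact isOpen_iInter_of_finite fun j => isOpen_iInter_of_finite fun _ =>
      isOpen_lt Metric.continuous_infEDist Metric.continuous_infEDist
  · refine disjoint_left.2 fun x hx hx' => ?_
    simp only [mem_iInter] at hx hx'
    have h1 : Metric.infEDist x (K i) < Metric.infEDist x (K j) := hx j hij
    exact h1.asymm (hx' i hij.symm)
  · simp only [mem_iInter]
    intro j hij
    change Metric.infEDist x (K i) < Metric.infEDist x (K j)
    rw [Metric.infEDist_zero_of_mem hx, pos_iff_ne_zero]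
    intro h0
    exact disjoint_left.1 (hd hij) hx
      ((Metric.mem_iff_infEDist_zero_of_closed (hK j)).2 h0)

/-- The composition of a finite family of sections over a compact set with an analytically trivial
covering is an analytically trivial covering. -/
theorem isAnalyticallyTrivialCover_of_isSectionFamily {A V G Φ : Type*} [NormedAddCommGroup A]
    [NormedSpace ℝ A] [NormedAddCommGroup V] [NormedSpace ℝ V] [NormedAddCommGroup G]
    [NormedSpace ℝ G] [Finite Φ] {r : A → V} {C : Set A} {Y : Set V} {s : Φ → V → A}
    (hs : IsSectionFamily r C Y s) (hr : AnalyticOnNhd ℝ r C) (hrY : MapsTo r C Y)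
    (hY : IsCompact Y) {q : V → G} {U : Set G} {F : Set ℝ} {σ : G × ℝ → V} (hF : F.Finite)
    (hσq : ∀ x ∈ U, ∀ c ∈ F, q (σ (x, c)) = x) (hσ : IsAnalyticIso σ (U ×ˢ F) (Y ∩ q ⁻¹' U))
    {Q : A → G} (hQa : AnalyticOnNhd ℝ Q C) (hQ : ∀ u ∈ C, Q u = q (r u)) :
    IsAnalyticallyTrivialCover Q C U := by
  classical
  obtain ⟨hbij, ⟨σ', hσ', hσσ'⟩, g, hg, g', hg', hgg'⟩ := hσ
  obtain ⟨B, hB0, hB⟩ : ∃ B : ℝ, 0 < B ∧ ∀ c ∈ F, |c| < B := by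
    obtain ⟨B, hB⟩ := (hF.image fun c => |c|).bddAbove
    exact ⟨|B| + 1, by positivity, fun c hc => by
      linarith [hB (mem_image_of_mem _ hc), le_abs_self B]⟩
  -- The product of `Φ` and `F` is realized on the real line by translating copies of `F` by
  -- multiples of `2 * B`, so that the copies lie in disjoint intervals.
  obtain ⟨ν, hν⟩ : ∃ ν : Φ → ℝ, ∀ i j c, |c - ν i| < B → |c - ν j| < B → i = j := by
    obtain ⟨m, ⟨e⟩⟩ := Finite.exists_equiv_fin Φ
    refine ⟨fun i => 2 * B * ((e i : ℕ) : ℝ), fun i j c hi hj => ?_⟩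
    by_contra hne
    have hne' : ((e i : ℕ) : ℤ) ≠ (e j : ℕ) := fun h => hne (e.injective (Fin.ext (by exact_mod_cast h)))
    have h1 : (1 : ℝ) ≤ |((e i : ℕ) : ℝ) - ((e j : ℕ) : ℝ)| := by
      have : 1 ≤ |((e i : ℕ) : ℤ) - (e j : ℕ)| := Int.one_le_abs (sub_ne_zero.2 hne')
      exact_mod_cast this
    have h2 : |2 * B * ((e i : ℕ) : ℝ) - 2 * B * ((e j : ℕ) : ℝ)| < 2 * B := by
      calc _ = |(c - 2 * B * ((e j : ℕ) : ℝ)) - (c - 2 * B * ((e i : ℕ) : ℝ))| := by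
            congr 1; ring
        _ ≤ _ := abs_sub _ _
        _ < 2 * B := by linarith
    rw [← mul_sub, abs_mul, abs_of_pos (by linarith : 0 < 2 * B)] at h2
    nlinarith
  have hfib : ∀ y ∈ Y ∩ q ⁻¹' U, ∃ c ∈ F, σ (q y, c) = y ∧ g y = (q y, c) := by
    intro y hy
    obtain ⟨⟨x, c⟩, ⟨hx, hc⟩, rfl⟩ := hbij.surjOn hy
    rw [hσq x hx c hc]
    exact ⟨c, hc, rfl, hg.1 ⟨hx, hc⟩⟩
  let F' : Set ℝ := ⋃ i, (fun c => c + ν i) '' F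
  let τ : G × ℝ → A := fun x =>
    if h : ∃ i, |x.2 - ν i| < B then s h.choose (σ (x.1, x.2 - ν h.choose)) else 0
  have hτ : ∀ i x c, |c - ν i| < B → τ (x, c) = s i (σ (x, c - ν i)) := by
    intro i x c hi
    have hex : ∃ i, |c - ν i| < B := ⟨i, hi⟩
    have : hex.choose = i := hν _ _ c hex.choose_spec hi
    simp only [τ, hex, dif_pos, this]
  let γ : A → G × ℝ := fun u =>
    if h : ∃ i, s i (r u) = u then (Q u, (g (r u)).2 + ν h.choose) else 0
  have hγ : ∀ i, ∀ u ∈ C, s i (r u) = u → γ u = (Q u, (g (r u)).2 + ν i) := by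
    intro i u hu hi
    have hex : ∃ i, s i (r u) = u := ⟨i, hi⟩
    have : hex.choose = i := hs.injective _ (hrY hu) (hex.choose_spec.trans hi.symm)
    simp only [γ, hex, dif_pos, this]
  have hτF : ∀ i x, ∀ c ∈ F, τ (x, c + ν i) = s i (σ (x, c)) := by
    intro i x c hc
    rw [hτ i x _ (by rw [add_sub_cancel_right]; exact hB c hc), add_sub_cancel_right]
  have hσY : ∀ x ∈ U, ∀ c ∈ F, σ (x, c) ∈ Y := fun x hx c hc => (hbij.mapsTo ⟨hx, hc⟩).1
  have hmap : MapsTo τ (U ×ˢ F') (C ∩ Q ⁻¹' U) := by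
    rintro ⟨x, c'⟩ ⟨hx, hc'⟩
    obtain ⟨i, c, hc, rfl⟩ := mem_iUnion.1 hc'
    simp only
    rw [hτF i x c hc]
    have hm := hs.mem i _ (hσY x hx c hc)
    refine ⟨hm, ?_⟩
    rw [mem_preimage, hQ _ hm, hs.right_inv i _ (hσY x hx c hc), hσq x hx c hc]
    exact hx
  have hrU : ∀ u ∈ C ∩ Q ⁻¹' U, r u ∈ Y ∩ q ⁻¹' U := by
    rintro u ⟨hu, huU⟩
    refine ⟨hrY hu, ?_⟩
    rw [mem_preimage, ← hQ u hu]
    exact huU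
  have hmap' : MapsTo γ (C ∩ Q ⁻¹' U) (U ×ˢ F') := by
    rintro u hu
    obtain ⟨i, hi⟩ := hs.complete u hu.1 (hrY hu.1)
    obtain ⟨c, hc, -, hgc⟩ := hfib _ (hrU u hu)
    rw [hγ i u hu.1 hi, hgc]
    exact ⟨hu.2, mem_iUnion.2 ⟨i, c, hc, rfl⟩⟩
  have hinv : InvOn γ τ (U ×ˢ F') (C ∩ Q ⁻¹' U) := by
    constructor
    · rintro ⟨x, c'⟩ ⟨hx, hc'⟩
      obtain ⟨i, c, hc, rfl⟩ := mem_iUnion.1 hc'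
      simp only
      have hy := hσY x hx c hc
      have hm := hs.mem i _ hy
      rw [hτF i x c hc, hγ i _ hm (by rw [hs.right_inv i _ hy]), hQ _ hm, hs.right_inv i _ hy,
        hσq x hx c hc,
        hg.1 (show (x, c) ∈ U ×ˢ F from ⟨hx, hc⟩)]
    · intro u hu
      obtain ⟨i, hi⟩ := hs.complete u hu.1 (hrY hu.1)
      obtain ⟨c, hc, hσc, hgc⟩ := hfib _ (hrU u hu)
      rw [hγ i u hu.1 hi, hgc, hτF i _ c hc, hQ u hu.1, hσc, hi]
  refine ⟨F', τ, finite_iUnion fun i => hF.image _, ?_, hinv.bijOn hmap hmap', ?_, γ, hinv, ?_⟩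
  · rintro x hx c' hc'
    obtain ⟨i, c, hc, rfl⟩ := mem_iUnion.1 hc'
    simp only
    have hy := hσY x hx c hc
    rw [hτF i x c hc, hQ _ (hs.mem i _ hy), hs.right_inv i _ hy, hσq x hx c hc]
  · refine isAnalyticMapOn_of_pieces (ι := Φ) (O := fun i => {x | |x.2 - ν i| < B}) (fun i => ?_)
      (fun i j hij => ?_) ?_ (fun i x => s i (σ' (x.1, x.2 - ν i))) ?_
    · exact isOpen_lt (by fun_prop) continuous_const
    · exact disjoint_left.2 fun x hx hx' => hij (hν _ _ _ hx hx')
    · rintro ⟨x, c'⟩ ⟨hx, hc'⟩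
      obtain ⟨i, c, hc, rfl⟩ := mem_iUnion.1 hc'
      refine mem_iUnion.2 ⟨i, ?_⟩
      change |c + ν i - ν i| < B
      rw [add_sub_cancel_right]
      exact hB c hc
    · rintro j ⟨x, c'⟩ ⟨⟨hx, hc'⟩, hj⟩
      obtain ⟨i, c, hc, rfl⟩ := mem_iUnion.1 hc'
      obtain rfl : i = j := hν i j (c + ν i) (by rw [add_sub_cancel_right]; exact hB c hc) hj
      simp only
      have hσσ := hσσ' (mk_mem_prod hx hc)
      refine ⟨?_, ?_⟩
      · have h1 : AnalyticAt ℝ (fun x : G × ℝ => (x.1, x.2 - ν i)) (x, c + ν i) :=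
          analyticAt_fst.prod (analyticAt_snd.sub analyticAt_const)
        have h2 : AnalyticAt ℝ σ' (x, c + ν i - ν i) := by
          rw [add_sub_cancel_right]; exact hσ' _ ⟨hx, hc⟩
        have h3 : AnalyticAt ℝ (s i) (σ' (x, c + ν i - ν i)) := by
          rw [add_sub_cancel_right, ← hσσ]; exact hs.analytic i _ (hσY x hx c hc)
        exact AnalyticAt.comp (g := s i) (f := fun x : G × ℝ => σ' (x.1, x.2 - ν i)) h3
          (AnalyticAt.comp (g := σ') (f := fun x : G × ℝ => (x.1, x.2 - ν i)) h2 h1)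
      · rw [hτF i x c hc, add_sub_cancel_right, hσσ]
  -- The inverse must locate the sheet of a point analytically. As `Y` is compact, the sheets are
  -- compact, and they are disjoint, so the sheet number is constant on disjoint open
  -- neighbourhoods.
  · obtain ⟨O, hO, hd, hKO⟩ := exists_disjoint_open_nhds (K := fun i => s i '' Y) (fun i =>
        (hY.image_of_continuousOn (hs.analytic i).continuousOn).isClosed) (by
      intro i j hij
      rw [disjoint_left]
      rintro _ ⟨x, hx, rfl⟩ ⟨y, hy, hxy⟩
      have h1 := congrArg r hxy
      rw [hs.right_inv j y hy, hs.right_inv i x hx] at h1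
      subst h1
      exact hij (hs.injective _ hy hxy).symm)
    have hmem : ∀ u ∈ C, ∃ i, u ∈ O i ∧ s i (r u) = u := by
      intro u hu
      obtain ⟨i, hi⟩ := hs.complete u hu (hrY hu)
      exact ⟨i, hKO i ⟨r u, hrY hu, hi⟩, hi⟩
    refine isAnalyticMapOn_of_pieces hO hd (fun u hu => mem_iUnion.2 ((hmem u hu.1).imp fun i h => h.1))
      (fun i u => (Q u, (g' (r u)).2 + ν i)) ?_
    rintro i u ⟨hu, hi⟩
    obtain ⟨j, hj, hsj⟩ := hmem u hu.1
    obtain rfl : i = j := by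
      by_contra hij
      exact disjoint_left.1 (hd hij) hi hj
    refine ⟨(hQa u hu.1).prod ?_, ?_⟩
    · exact (analyticAt_snd.comp
        (AnalyticAt.comp (hg' _ (hrU u hu)) (hr u hu.1))).add analyticAt_const
    · rw [hγ i u hu.1 hsj, hgg' (hrU u hu)]

/-! ### Compact algebraic sets and their linkages -/

/-- Hilbert's basis theorem. -/
theorem IsRealAlgebraicSet.exists_finite {N : ℕ} {Y : Set (Fin N → ℝ)} (hY : IsRealAlgebraicSet Y) :
    ∃ T : Set (MvPolynomial (Fin N) ℝ), T.Finite ∧ Y = {y | ∀ P ∈ T, MvPolynomial.eval y P = 0} := by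
  obtain ⟨S, rfl⟩ := hY
  obtain ⟨T, hT⟩ := IsNoetherian.noetherian (Ideal.span S)
  refine ⟨T, T.finite_toSet, ?_⟩
  have key : ∀ (A : Set (MvPolynomial (Fin N) ℝ)) (y : Fin N → ℝ),
      (∀ P ∈ A, MvPolynomial.eval y P = 0) ↔
        Ideal.span A ≤ RingHom.ker (MvPolynomial.eval y) := by
    intro A y
    rw [Ideal.span_le]
    rfl
  ext y
  simp only [mem_ofPred_eq]
  rw [key, key, ← hT]

/-- Over a cube containing `Y`, each defining polynomial `P` is realized as the vector `P e` and set
to zero by one linear equation. Now `Z` and `D` coincide, so the system is controlled over its whole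
image. -/
theorem realizes_algebraic {n : ℕ} (hn : 2 ≤ n) {N : ℕ} {Y : Set (Fin N → ℝ)}
    (hY : IsRealAlgebraicSet Y) (hYc : IsCompact Y)
    {𝒢 : Set ((Fin N → ℝ) → EuclideanSpace ℝ (Fin n))} (h𝒢 : 𝒢.Finite)
    (hP : ∀ g ∈ 𝒢, ∀ j, ∃ P : MvPolynomial (Fin N) ℝ, ∀ x, g x j = MvPolynomial.eval x P) :
    Realizes Y Y 𝒢 := by
  obtain ⟨T, hT, hYT⟩ := hY.exists_finite
  obtain ⟨δ, hδ, hYδ⟩ : ∃ δ, 0 < δ ∧ Y ⊆ Set.pi univ fun _ : Fin N => Icc (-δ) δ := by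
    obtain ⟨δ, hδ⟩ := hYc.isBounded.exists_norm_le
    exact ⟨|δ| + 1, by positivity, fun y hy i _ => abs_le.1
      ((norm_le_pi_norm y i).trans ((hδ y hy).trans (by linarith [le_abs_self δ])))⟩
  let e : EuclideanSpace ℝ (Fin n) := EuclideanSpace.single ⟨0, by omega⟩ 1
  have he : e ≠ 0 := by simp [e]
  let G : MvPolynomial (Fin N) ℝ → (Fin N → ℝ) → EuclideanSpace ℝ (Fin n) :=
    fun P x => MvPolynomial.eval x P • e
  have h1 := realizes_polynomial hn hδ (h𝒢.union (hT.image G)) (by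
    rintro _ (hg | ⟨P, -, rfl⟩) j
    · exact hP _ hg j
    · exact ⟨P * MvPolynomial.C (e j), fun x => by simp [G]⟩)
  have h2 : ∀ T' : Set (MvPolynomial (Fin N) ℝ), T'.Finite → T' ⊆ T →
      Realizes (univ ∩ {y | ∀ P ∈ T', MvPolynomial.eval y P = 0})
        ((Set.pi univ fun _ : Fin N => Icc (-δ) δ) ∩ {y | ∀ P ∈ T', MvPolynomial.eval y P = 0})
        (𝒢 ∪ G '' T) := by
    intro T' hT' hTT
    induction T', hT' using Set.Finite.induction_on with
    | empty => simpa using h1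
    | @insert P T' _ _ ih =>
      rw [insert_subset_iff] at hTT
      have := (ih hTT.2).constraint (Or.inr ⟨P, hTT.1, rfl⟩) 0
      have hset : {y : Fin N → ℝ | ∀ Q ∈ insert P T', MvPolynomial.eval y Q = 0} =
          {y | ∀ Q ∈ T', MvPolynomial.eval y Q = 0} ∩ {y | G P y = 0} := by
        ext y
        simp only [forall_mem_insert, mem_ofPred_eq, mem_inter_iff, G, smul_eq_zero, he, or_false]
        tauto
      rw [hset, ← inter_assoc, ← inter_assoc]
      exact this
  refine (h2 T hT Subset.rfl).mono ?_ ?_ fun g hg =>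
    ⟨g, Submodule.subset_span (Or.inl hg), fun _ _ => rfl⟩
  · rw [univ_inter, hYT]
  · rw [← hYT]
    exact subset_inter hYδ Subset.rfl

/-- A linkage without configurations: an edge of length one, both ends of which are fixed at `0`. -/
def emptyLinkage (n : ℕ) : ClassicalLinkage n where
  Vertex := Bool
  vertexFintype := inferInstance
  graph := ⊤
  length := fun _ => 1
  length_pos := fun _ => one_pos
  fixed := univ
  position := fun _ => 0

theorem configSpace_emptyLinkage (n : ℕ) : (emptyLinkage n).configSpace = ∅ := by
  refine eq_empty_iff_forall_notMem.2 fun φ hφ => ?_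
  have hadj : (emptyLinkage n).graph.Adj true false := by simp [emptyLinkage]
  have h1 := hφ.2 true false hadj
  have h2 := hφ.1 ⟨true, trivial⟩
  have h3 := hφ.1 ⟨false, trivial⟩
  change φ true = 0 at h2
  change φ false = 0 at h3
  change dist (φ true) (φ false) = 1 at h1
  rw [h2, h3] at h1
  simp at h1

theorem isAnalyticIso_empty {E G : Type*} [NormedAddCommGroup E] [NormedSpace ℝ E]
    [NormedAddCommGroup G] [NormedSpace ℝ G] (g : E → G) : IsAnalyticIso g ∅ ∅ :=
  ⟨bijOn_empty g, ⟨g, fun _ h => h.elim, fun _ h => h.elim⟩, fun _ => 0,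
    ⟨fun _ h => h.elim, fun _ h => h.elim⟩, fun _ => 0, fun _ h => h.elim, fun _ h => h.elim⟩

theorem exists_functional_linkage {n k m : ℕ} (hn : 2 ≤ n)
    {X : Set (Fin k → EuclideanSpace ℝ (Fin n))} {f : X → Fin m → EuclideanSpace ℝ (Fin n)}
    {U : Set (Fin k → EuclideanSpace ℝ (Fin n))} (hU : U ⊆ X) {N : ℕ} {Y : Set (Fin N → ℝ)}
    {q : (Fin N → ℝ) → Fin k → EuclideanSpace ℝ (Fin n)}
    {p : (Fin N → ℝ) → Fin m → EuclideanSpace ℝ (Fin n)} (hq : MapsTo q Y X)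
    {F : Set ℝ} {σ : (Fin k → EuclideanSpace ℝ (Fin n)) × ℝ → Fin N → ℝ}
    (hY : IsRealAlgebraicSet Y) (hYc : IsCompact Y) (hqP : IsPolynomialMap q)
    (hpP : IsPolynomialMap p) (hF : F.Finite)
    (hpf : ∀ (y : Fin N → ℝ) (hy : y ∈ Y), p y = f ⟨q y, hq hy⟩) (hqX : SurjOn q Y X)
    (hσq : ∀ x ∈ U, ∀ c ∈ F, q (σ (x, c)) = x) (hσ : IsAnalyticIso σ (U ×ˢ F) (Y ∩ q ⁻¹' U)) :
    ∃ L : ClassicalLinkage n, L.IsFunctional f U := by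
  -- The grid construction needs a reference solution, so empty `Y` requires its own linkage.
  rcases Y.eq_empty_or_nonempty with rfl | hne
  · have hX : X = ∅ := by simpa [SurjOn] using hqX
    subst hX
    obtain rfl : U = ∅ := subset_empty_iff.1 hU
    refine ⟨emptyLinkage n, fun _ => true, fun _ => true, ?_, ?_, Subset.rfl, ∅, fun _ => 0,
      finite_empty, ?_, ?_⟩
    · rw [configSpace_emptyLinkage, image_empty]
    · rintro φ - ⟨⟩
    · rintro x ⟨⟩
    · rw [configSpace_emptyLinkage, empty_prod, empty_inter]
      exact isAnalyticIso_empty _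
  let 𝒢 : Set ((Fin N → ℝ) → EuclideanSpace ℝ (Fin n)) :=
    (range fun i x => q x i) ∪ range fun i x => p x i
  have h := realizes_algebraic hn hY hYc (𝒢 := 𝒢) ((finite_range _).union (finite_range _)) (by
    rintro _ (⟨i, rfl⟩ | ⟨i, rfl⟩) j
    · exact hqP i j
    · exact hpP i j)
  obtain ⟨ι, _, S, r, Φ, _, ⟨i₀⟩, s, hS, hr, hrY, hc, hs⟩ := h
  choose cq hcq using fun i => hc _ (Or.inl ⟨i, rfl⟩)
  choose cp hcp using fun i => hc _ (Or.inr ⟨i, rfl⟩)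
  obtain ⟨y₀, hy₀⟩ := hne
  obtain ⟨L, Λ, Γ, hΓ, hL, hO⟩ := hS.exists_linkage ⟨_, hs.mem i₀ y₀ hy₀⟩
    ((finite_range cq).union (finite_range cp))
  choose w hw using fun i => hO _ (Or.inl ⟨i, rfl⟩)
  choose v hv using fun i => hO _ (Or.inr ⟨i, rfl⟩)
  have hqw : ∀ u ∈ S, L.positions w (Λ u) = q (r u) := fun u hu => by
    funext i
    exact (hw i u).trans (hcq i u hu)
  have hpv : ∀ u ∈ S, L.positions v (Λ u) = p (r u) := fun u hu => by
    funext i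
    exact (hv i u).trans (hcp i u hu)
  refine ⟨L, w, v, ?_, ?_, hU, ?_⟩
  · rw [hL]
    apply Subset.antisymm
    · rintro _ ⟨_, ⟨u, hu, rfl⟩, rfl⟩
      rw [hqw u hu]
      exact hq (hrY hu)
    · intro x hx
      obtain ⟨y, hy, rfl⟩ := hqX hx
      have hu := hs.mem i₀ y hy
      exact ⟨_, ⟨_, hu, rfl⟩, by rw [hqw _ hu, hs.right_inv _ _ hy]⟩
  · rw [hL]
    rintro _ ⟨u, hu, rfl⟩ hX
    rw [hpv u hu, hpf _ (hrY hu)]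
    congr 1
    exact Subtype.ext (hqw u hu).symm
  · have hs' : IsSectionFamily (fun φ => r (Γ φ)) L.configSpace Y fun i y => Λ (s i y) := by
      rw [hL]
      refine ⟨fun i y hy => ?_, fun i y hy => ⟨_, hs.mem i y hy, rfl⟩, fun i y hy => ?_, ?_, ?_⟩
      · exact (Λ.analyticAt _).comp (hs.analytic i y hy)
      · rw [hΓ, hs.right_inv i y hy]
      · rintro _ ⟨u, hu, rfl⟩ hD
        rw [hΓ] at hD ⊢
        obtain ⟨i, hi⟩ := hs.complete u hu hD
        exact ⟨i, by rw [hi]⟩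
      · intro y hy i j hij
        refine hs.injective y hy ?_
        have := congrArg Γ hij
        simpa only [hΓ] using this
    refine isAnalyticallyTrivialCover_of_isSectionFamily hs' ?_ ?_ hYc hF hσq hσ ?_ ?_
    · rw [hL]
      rintro _ ⟨u, hu, rfl⟩
      have h1 : AnalyticAt ℝ r (Γ (Λ u)) := by rw [hΓ]; exact hr u hu
      exact AnalyticAt.comp (g := r) h1 (Γ.analyticAt _)
    · rw [hL]
      rintro _ ⟨u, hu, rfl⟩
      change r (Γ (Λ u)) ∈ Y
      rw [hΓ]
      exact hrY hu
    · intro φ _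
      exact analyticAt_pi_iff.2 fun i => (contDiff_apply ℝ _ (w i)).contDiffAt.analyticAt
    · rw [hL]
      rintro _ ⟨u, hu, rfl⟩
      rw [hΓ, hqw u hu]

/-! ### From a linkage to a compact algebraic set -/

theorem isRealAlgebraicSet_iInter_zeros {N : ℕ} {ι : Type*} (P : ι → MvPolynomial (Fin N) ℝ) :
    IsRealAlgebraicSet {y | ∀ i, MvPolynomial.eval y (P i) = 0} :=
  ⟨range P, by simp⟩

theorem IsRealAlgebraicSet.inter {N : ℕ} {Y Y' : Set (Fin N → ℝ)} (h : IsRealAlgebraicSet Y)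
    (h' : IsRealAlgebraicSet Y') : IsRealAlgebraicSet (Y ∩ Y') := by
  obtain ⟨S, rfl⟩ := h
  obtain ⟨S', rfl⟩ := h'
  refine ⟨S ∪ S', ?_⟩
  ext y
  simp only [mem_inter_iff, mem_ofPred_eq, mem_union, or_imp, forall_and]

theorem IsRealAlgebraicSet.isClosed {N : ℕ} {Y : Set (Fin N → ℝ)} (h : IsRealAlgebraicSet Y) :
    IsClosed Y := by
  obtain ⟨S, rfl⟩ := h
  simp only [ofPred_forall]
  exact isClosed_iInter fun P => isClosed_iInter fun _ =>
    isClosed_eq (MvPolynomial.continuous_eval P) continuous_const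

theorem IsAnalyticIso.trans_continuousLinearEquiv {E G G' : Type*} [NormedAddCommGroup E]
    [NormedSpace ℝ E] [NormedAddCommGroup G] [NormedSpace ℝ G] [NormedAddCommGroup G']
    [NormedSpace ℝ G'] {g : E → G} {A : Set E} {B : Set G} (h : IsAnalyticIso g A B) (e : G ≃L[ℝ] G') :
    IsAnalyticIso (fun x => e (g x)) A (e.symm ⁻¹' B) := by
  obtain ⟨hb, ⟨h, ha, hgh⟩, g', hg', h', ha', hgh'⟩ := h
  have h1 : MapsTo (fun x => e (g x)) A (e.symm ⁻¹' B) := fun x hx => by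
    simpa using hb.mapsTo hx
  have h2 : MapsTo (fun y => g' (e.symm y)) (e.symm ⁻¹' B) A := fun y hy => by
    obtain ⟨x, hx, hxy⟩ := hb.surjOn hy
    change g' (e.symm y) ∈ A
    rw [← hxy, hg'.1 hx]
    exact hx
  have h3 : InvOn (fun y => g' (e.symm y)) (fun x => e (g x)) A (e.symm ⁻¹' B) := by
    refine ⟨fun x hx => ?_, fun y hy => ?_⟩
    · simpa using hg'.1 hx
    · change e (g (g' (e.symm y))) = y
      rw [hg'.2 hy, e.apply_symm_apply]
  refine ⟨h3.bijOn h1 h2, ⟨fun x => e (h x), fun x hx => ?_, fun x hx => ?_⟩, _, h3,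
    fun y => h' (e.symm y), fun y hy => ?_, fun y hy => hgh' hy⟩
  · exact ((e : G →L[ℝ] G').analyticAt _).comp (ha x hx)
  · exact congrArg e (hgh hx)
  · exact AnalyticAt.comp (g := h') (ha' _ hy) ((e.symm : G' →L[ℝ] G).analyticAt y)

namespace ClassicalLinkage

variable {n : ℕ}

/-- The real coordinates of a map from the vertices to `ℝⁿ`. -/
noncomputable def coordinates (L : ClassicalLinkage n) :
    (L.Vertex → EuclideanSpace ℝ (Fin n)) ≃L[ℝ] (Fin (Fintype.card (L.Vertex × Fin n)) → ℝ) :=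
  LinearEquiv.toContinuousLinearEquiv
    { toFun := fun φ a => φ ((Fintype.equivFin _).symm a).1 ((Fintype.equivFin _).symm a).2
      invFun := fun y v => WithLp.toLp 2 fun j => y (Fintype.equivFin _ (v, j))
      map_add' := fun _ _ => rfl
      map_smul' := fun _ _ => rfl
      left_inv := fun φ => by ext v j; simp
      right_inv := fun y => by ext a; simp }

theorem isRealAlgebraicSet_configSpace (L : ClassicalLinkage n) :
    IsRealAlgebraicSet (L.coordinates.symm ⁻¹' L.configSpace) := by
  let x : L.Vertex → Fin n → MvPolynomial (Fin (Fintype.card (L.Vertex × Fin n))) ℝ :=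
    fun v j => MvPolynomial.X (Fintype.equivFin _ (v, j))
  have h1 := isRealAlgebraicSet_iInter_zeros fun i : L.fixed × Fin n =>
    x i.1 i.2 - MvPolynomial.C (L.position i.1 i.2)
  have h2 := isRealAlgebraicSet_iInter_zeros
    fun i : {i : L.Vertex × L.Vertex // L.graph.Adj i.1 i.2} =>
      ∑ j, (x i.1.1 j - x i.1.2 j) ^ 2 - MvPolynomial.C (L.length ⟨s(i.1.1, i.1.2), i.2⟩ ^ 2)
  convert h1.inter h2 using 1
  ext y
  simp only [configSpace, mem_preimage, mem_ofPred_eq, mem_inter_iff, Prod.forall, Subtype.forall, x,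
    map_sub, map_sum, map_pow, MvPolynomial.eval_X, MvPolynomial.eval_C, sub_eq_zero]
  refine and_congr ?_ ?_
  · refine forall₂_congr fun v hv => ?_
    rw [PiLp.ext_iff]
    exact Iff.rfl
  · refine forall₃_congr fun v w h => ?_
    rw [← sq_eq_sq₀ dist_nonneg (L.length_pos _).le, EuclideanSpace.dist_sq_eq]
    simp only [Real.dist_eq, sq_abs]
    exact Iff.rfl

/-- The vertices whose positions are bounded on the configuration space. -/
def boundedVertices (L : ClassicalLinkage n) : Set L.Vertex :=
  {v | ∃ B, ∀ φ ∈ L.configSpace, ‖φ v‖ ≤ B}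

theorem mem_boundedVertices_of_mem_fixed (L : ClassicalLinkage n) {v : L.Vertex} (hv : v ∈ L.fixed) :
    v ∈ L.boundedVertices :=
  ⟨‖L.position ⟨v, hv⟩‖, fun _ hφ => (congrArg norm (hφ.1 ⟨v, hv⟩)).le⟩

theorem mem_boundedVertices_of_adj (L : ClassicalLinkage n) {v w : L.Vertex}
    (h : L.graph.Adj v w) (hv : v ∈ L.boundedVertices) : w ∈ L.boundedVertices := by
  obtain ⟨B, hB⟩ := hv
  refine ⟨B + L.length ⟨s(v, w), h⟩, fun φ hφ => ?_⟩
  have h1 := hφ.2 v w h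
  rw [dist_eq_norm] at h1
  calc ‖φ w‖ = ‖φ v - (φ v - φ w)‖ := by rw [sub_sub_cancel]
    _ ≤ ‖φ v‖ + ‖φ v - φ w‖ := norm_sub_le _ _
    _ ≤ _ := by rw [h1]; linarith [hB φ hφ]

-- The bounded vertices contain the fixed ones and are closed under adjacency, so no constraint
-- links them to the others.
open Classical in
theorem piecewise_mem_configSpace (L : ClassicalLinkage n)
    {φ ψ : L.Vertex → EuclideanSpace ℝ (Fin n)} (hφ : φ ∈ L.configSpace) (hψ : ψ ∈ L.configSpace) :
    L.boundedVertices.piecewise φ ψ ∈ L.configSpace := by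
  refine ⟨fun v => ?_, fun v w h => ?_⟩
  · rw [piecewise_eq_of_mem _ _ _ (L.mem_boundedVertices_of_mem_fixed v.2)]
    exact hφ.1 v
  · by_cases hv : v ∈ L.boundedVertices
    · rw [piecewise_eq_of_mem _ _ _ hv,
        piecewise_eq_of_mem _ _ _ (L.mem_boundedVertices_of_adj h hv)]
      exact hφ.2 v w h
    · have hw : w ∉ L.boundedVertices := fun hw => hv (L.mem_boundedVertices_of_adj h.symm hw)
      rw [piecewise_eq_of_notMem _ _ _ hv, piecewise_eq_of_notMem _ _ _ hw]
      exact hψ.2 v w h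

/-- Over one point of `U` the fibre is finite, yet the unbounded part of a configuration could be
replaced by that of any other without changing the inputs. -/
theorem mem_boundedVertices_of_isAnalyticallyTrivialCover (L : ClassicalLinkage n) {k : ℕ}
    {w : Fin k → L.Vertex} (hw : ∀ i, w i ∈ L.boundedVertices)
    {U : Set (Fin k → EuclideanSpace ℝ (Fin n))} (hUX : U ⊆ L.positions w '' L.configSpace)
    (hU : U.Nonempty) (h : IsAnalyticallyTrivialCover (L.positions w) L.configSpace U)
    (v : L.Vertex) : v ∈ L.boundedVertices := by
  classical
  by_contra hv
  obtain ⟨F, σ, hF, hσ, hbij, -⟩ := h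
  obtain ⟨x, hx⟩ := hU
  obtain ⟨φ, hφ, rfl⟩ := hUX hx
  obtain ⟨B, hB⟩ := (hF.image fun c => ‖σ (L.positions w φ, c) v‖).bddAbove
  refine hv ⟨B, fun ψ hψ => ?_⟩
  have h1 : L.positions w (L.boundedVertices.piecewise φ ψ) = L.positions w φ := by
    funext i
    exact piecewise_eq_of_mem _ _ _ (hw i)
  obtain ⟨⟨x, c⟩, ⟨hxU, hc⟩, hxc⟩ := hbij.surjOn
    (show L.boundedVertices.piecewise φ ψ ∈ L.configSpace ∩ L.positions w ⁻¹' U from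
      ⟨L.piecewise_mem_configSpace hφ hψ, by rw [mem_preimage, h1]; exact hx⟩)
  have h2 := hσ x hxU c hc
  rw [hxc, h1] at h2
  subst h2
  have h3 := hB (mem_image_of_mem _ hc)
  simp only [hxc] at h3
  rwa [piecewise_eq_of_notMem _ _ _ hv] at h3

theorem IsFunctional.exists_algebraic {k m : ℕ} {L : ClassicalLinkage n}
    {X : Set (Fin k → EuclideanSpace ℝ (Fin n))} (hX : IsCompact X)
    {f : X → Fin m → EuclideanSpace ℝ (Fin n)} {U : Set (Fin k → EuclideanSpace ℝ (Fin n))}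
    (h : L.IsFunctional f U) :
    ∃ (N : ℕ) (Y : Set (Fin N → ℝ))
      (q : (Fin N → ℝ) → Fin k → EuclideanSpace ℝ (Fin n))
      (p : (Fin N → ℝ) → Fin m → EuclideanSpace ℝ (Fin n))
      (hq : MapsTo q Y X)
      (F : Set ℝ) (σ : (Fin k → EuclideanSpace ℝ (Fin n)) × ℝ → Fin N → ℝ),
      IsRealAlgebraicSet Y ∧ IsCompact Y ∧
      IsPolynomialMap q ∧ IsPolynomialMap p ∧
      F.Finite ∧
      (∀ (y : Fin N → ℝ) (hy : y ∈ Y), p y = f ⟨q y, hq hy⟩) ∧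
      SurjOn q Y X ∧
      (∀ x ∈ U, ∀ c ∈ F, q (σ (x, c)) = x) ∧
      IsAnalyticIso σ (U ×ˢ F) (Y ∩ q ⁻¹' U) := by
  classical
  obtain ⟨w, v, hwX, hvf, hUX, hcov⟩ := h
  obtain ⟨φ₀, hφ₀⟩ : ∃ φ₀ : L.Vertex → EuclideanSpace ℝ (Fin n),
      L.configSpace.Nonempty → φ₀ ∈ L.configSpace := by
    by_cases h : L.configSpace.Nonempty
    · exact ⟨h.some, fun _ => h.some_mem⟩
    · exact ⟨0, fun h' => (h h').elim⟩
  -- The input positions range over the compact set `X`.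
  have hw : ∀ i, w i ∈ L.boundedVertices := by
    intro i
    obtain ⟨B, hB⟩ := hX.isBounded.exists_norm_le
    exact ⟨B, fun φ hφ => (norm_le_pi_norm (L.positions w φ) i).trans
      (hB _ (hwX ▸ mem_image_of_mem _ hφ))⟩
  -- Unbounded vertices are frozen at their positions in one configuration `φ₀`; this restores
  -- compactness without shrinking the image of the input map.
  let Y : Set (Fin (Fintype.card (L.Vertex × Fin n)) → ℝ) := L.coordinates.symm ⁻¹' L.configSpace ∩
    {y | ∀ i : (L.boundedVerticesᶜ : Set L.Vertex) × Fin n, MvPolynomial.eval y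
      (MvPolynomial.X (Fintype.equivFin _ (i.1.1, i.2)) - MvPolynomial.C (φ₀ i.1 i.2)) = 0}
  have hYa : IsRealAlgebraicSet Y :=
    L.isRealAlgebraicSet_configSpace.inter (isRealAlgebraicSet_iInter_zeros _)
  have hY : ∀ y, y ∈ Y ↔ L.coordinates.symm y ∈ L.configSpace ∧
      ∀ v ∉ L.boundedVertices, L.coordinates.symm y v = φ₀ v := by
    intro y
    refine and_congr Iff.rfl ?_
    simp only [mem_ofPred_eq, Prod.forall, Subtype.forall, map_sub, MvPolynomial.eval_X,
      MvPolynomial.eval_C, sub_eq_zero]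
    refine forall₂_congr fun v hv => ?_
    rw [PiLp.ext_iff]
    exact Iff.rfl
  have hYb : ∀ v, ∃ B, ∀ y ∈ Y, ‖L.coordinates.symm y v‖ ≤ B := by
    intro v
    by_cases hv : v ∈ L.boundedVertices
    · obtain ⟨B, hB⟩ := hv
      exact ⟨B, fun y hy => hB _ ((hY y).1 hy).1⟩
    · exact ⟨‖φ₀ v‖, fun y hy => by rw [((hY y).1 hy).2 v hv]⟩
  choose B hB using hYb
  let Q : (Fin (Fintype.card (L.Vertex × Fin n)) → ℝ) → Fin k → EuclideanSpace ℝ (Fin n) :=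
    fun y => L.positions w (L.coordinates.symm y)
  have hq : MapsTo Q Y X := fun y hy => hwX ▸ mem_image_of_mem _ ((hY y).1 hy).1
  obtain ⟨F, σ, hF, hσ, hiso⟩ := id hcov
  -- Freezing changes nothing over `U`: a point there makes `U` nonempty, and then every vertex is
  -- bounded.
  have hYU : Y ∩ Q ⁻¹' U = L.coordinates.symm ⁻¹' (L.configSpace ∩ L.positions w ⁻¹' U) := by
    ext y
    constructor
    · rintro ⟨hy, hyU⟩
      exact ⟨((hY y).1 hy).1, hyU⟩
    · rintro ⟨hy, hyU⟩
      exact ⟨(hY y).2 ⟨hy, fun v hv => (hv (L.mem_boundedVertices_of_isAnalyticallyTrivialCover hw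
        (hwX ▸ hUX) ⟨_, hyU⟩ hcov v)).elim⟩, hyU⟩
  refine ⟨_, Y, Q, fun y => L.positions v (L.coordinates.symm y), hq, F,
    fun x => L.coordinates (σ x), hYa, ?_, ?_, ?_, hF, ?_, ?_, ?_, ?_⟩
  · refine Metric.isCompact_of_isClosed_isBounded hYa.isClosed
      ((Metric.isBounded_iff_subset_closedBall 0).2 ⟨∑ v, |B v|, fun y hy => ?_⟩)
    rw [mem_closedBall_zero_iff, pi_norm_le_iff_of_nonneg (by positivity)]
    intro a
    obtain ⟨⟨v, j⟩, rfl⟩ := (Fintype.equivFin (L.Vertex × Fin n)).surjective a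
    calc ‖y (Fintype.equivFin _ (v, j))‖ = ‖L.coordinates.symm y v j‖ := rfl
      _ ≤ ‖L.coordinates.symm y v‖ := PiLp.norm_apply_le _ _
      _ ≤ B v := hB v y hy
      _ ≤ |B v| := le_abs_self _
      _ ≤ ∑ v, |B v| := Finset.single_le_sum (f := fun v => |B v|) (fun _ _ => abs_nonneg _)
        (Finset.mem_univ v)
  · exact fun i j => ⟨MvPolynomial.X (Fintype.equivFin _ (w i, j)), fun y => by
      rw [MvPolynomial.eval_X]; rfl⟩
  · exact fun i j => ⟨MvPolynomial.X (Fintype.equivFin _ (v i, j)), fun y => by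
      rw [MvPolynomial.eval_X]; rfl⟩
  · exact fun y hy => hvf _ ((hY y).1 hy).1 (hq hy)
  · intro x hx
    rw [← hwX] at hx
    obtain ⟨φ, hφ, rfl⟩ := hx
    refine ⟨L.coordinates (L.boundedVertices.piecewise φ φ₀), (hY _).2 ?_, ?_⟩
    · rw [L.coordinates.symm_apply_apply]
      exact ⟨L.piecewise_mem_configSpace hφ (hφ₀ ⟨φ, hφ⟩),
        fun v hv => piecewise_eq_of_notMem _ _ _ hv⟩
    · simp only [Q, L.coordinates.symm_apply_apply]
      funext i
      exact piecewise_eq_of_mem _ _ _ (hw i)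
  · intro x hx c hc
    simp only [Q, L.coordinates.symm_apply_apply]
    exact hσ x hx c hc
  · rw [hYU]
    exact hiso.trans_continuousLinearEquiv L.coordinates

end ClassicalLinkage

theorem mainTheorem10 {n k m : ℕ} (hn : 2 ≤ n)
    (X : Set (Fin k → EuclideanSpace ℝ (Fin n))) (hX : IsCompact X)
    (f : X → Fin m → EuclideanSpace ℝ (Fin n))
    (U : Set (Fin k → EuclideanSpace ℝ (Fin n))) (hU : U ⊆ X) :
    (∃ L : ClassicalLinkage n, L.IsFunctional f U) ↔
    ∃ (N : ℕ) (Y : Set (Fin N → ℝ))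
      (q : (Fin N → ℝ) → Fin k → EuclideanSpace ℝ (Fin n))
      (p : (Fin N → ℝ) → Fin m → EuclideanSpace ℝ (Fin n))
      (hq : MapsTo q Y X)
      (F : Set ℝ) (σ : (Fin k → EuclideanSpace ℝ (Fin n)) × ℝ → Fin N → ℝ),
      IsRealAlgebraicSet Y ∧ IsCompact Y ∧
      IsPolynomialMap q ∧ IsPolynomialMap p ∧
      F.Finite ∧
      (∀ (y : Fin N → ℝ) (hy : y ∈ Y), p y = f ⟨q y, hq hy⟩) ∧
      SurjOn q Y X ∧
      (∀ x ∈ U, ∀ c ∈ F, q (σ (x, c)) = x) ∧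
      IsAnalyticIso σ (U ×ˢ F) (Y ∩ q ⁻¹' U) := by
  constructor
  · rintro ⟨L, hL⟩
    exact hL.exists_algebraic hX
  · rintro ⟨N, Y, q, p, hq, F, σ, hY, hYc, hqP, hpP, hF, hpf, hqX, hσq, hσ⟩
    exact exists_functional_linkage hn hU hq hY hYc hqP hpP hF hpf hqX hσq hσ
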